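/- Let $d>2$, and let $K\subset\mathbb{R}^d$ be a porous compact set: $K$ is bounded and closed, and there is a constant $0<c<1$ such that every ball $B\subset\mathbb{R}^d$ contains a ball $B'$ with $B'\cap K=\emptyset$ and $|B'|\ge c|B|$, where $|\cdot|$ is Lebesgue measure. Let $\omega:[0,\infty)\to[0,\infty)$ be a modulus of continuity, that is, a continuous (not necessarily strictly) increasing concave function with $\omega(0)=0$. For a continuous $f:K\to\mathbb{R}$ put $$\|f\|_\omega=\sup_{x,y\in K,\ x\ne y}\frac{|f(x)-f(y)|}{\omega(|x-y|)}\in[0,\infty]$$ (with $0/0=0$ and $a/0=\infty$ for $a>0$), and write $f\in \mathrm{Lip}_\omega(K)$ if $\|f\|_\omega<\infty$. For $\delta>0$ let $K_\delta=\{x\in\mathbb{R}^d:\inf_{y\in K}|x-y|<\delta\}$ be the $\delta$-neighbourhood of $K$. For numbers $A_1,A_2$ say that $f$ satisfies $(\mathrm{H}_{A_1,A_2})$ if for every $\delta>0$ there is a function $G_\delta$ harmonic in $K_\delta$ such that $$\sup_K|f-G_\delta|\le A_1\,\omega(\delta)\qquad\text{and}\qquad \sup_{K_\delta}|\nabla G_\delta|\le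 A_2\,\frac{\omega(\delta)}{\delta}.$$ Then there are constants $C_1,C_2>0$, which do not depend on $f$ or on $\delta$, such that for every continuous function $f:K\to\mathbb{R}$: 1. $f\in \mathrm{Lip}_\omega(K)$ if and only if $f$ satisfies $(\mathrm{H}_{A_1,A_2})$ for some finite constants $A_1,A_2$ (which may depend on $f$, but not on $\delta$); 2. if $f\in \mathrm{Lip}_\omega(K)$, then $f$ satisfies $(\mathrm{H}_{A_1,A_2})$ with $A_1=C_1\|f\|_\omega$ and $A_2=C_2\|f\|_\omega$; that is, for every $\delta>0$ there is $G_\delta$ harmonic in $K_\delta$ with $\sup_K|f-G_\delta|\le C_1\|f\|_\omega\,\omega(\delta)$ and $\sup_{K_\delta}|\nabla G_\delta|\le C_2\|f\|_\omega\,\omega(\delta)/\delta$. -/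

import Mathlib

open scoped ENNReal

/-- A bounded closed set `K` in `ℝ^d` is porous if, for some constant `0 < c < 1`, every ball `B`
contains a ball `B'` which does not meet `K` and satisfies `|B'| ≥ c |B|` (Lebesgue measure). -/
structure IsPorousCompact {d : ℕ} (K : Set (EuclideanSpace ℝ (Fin d))) : Prop where
  isBounded : Bornology.IsBounded K
  isClosed : IsClosed K
  exists_hole : ∃ c : ℝ, 0 < c ∧ c < 1 ∧
    ∀ (x : EuclideanSpace ℝ (Fin d)) (r : ℝ), 0 < r →
      ∃ (y : EuclideanSpace ℝ (Fin d)) (s : ℝ), 0 < s ∧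
        Metric.ball y s ⊆ Metric.ball x r ∧
        Metric.ball y s ∩ K = ∅ ∧
        ENNReal.ofReal c * MeasureTheory.volume (Metric.ball x r) ≤
          MeasureTheory.volume (Metric.ball y s)

/-- A modulus of continuity: a continuous increasing (possibly not strictly) concave function
`[0, ∞) → [0, ∞)` that vanishes at `0`. Only the values of `ω` on `[0, ∞)` are used. -/
structure IsModulusOfContinuity (ω : ℝ → ℝ) : Prop where
  continuousOn : ContinuousOn ω (Set.Ici 0)
  monotoneOn : MonotoneOn ω (Set.Ici 0)
  concaveOn : ConcaveOn ℝ (Set.Ici 0) ω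
  nonneg : ∀ t : ℝ, 0 ≤ t → 0 ≤ ω t
  map_zero : ω 0 = 0

/-- The semi-norm `sup_{x, y ∈ K, x ≠ y} |f x - f y| / ω |x - y|`, as a number in `[0, ∞]`. -/
noncomputable def lipSeminorm {d : ℕ} (ω : ℝ → ℝ) (K : Set (EuclideanSpace ℝ (Fin d)))
    (f : EuclideanSpace ℝ (Fin d) → ℝ) : ℝ≥0∞ :=
  ⨆ (x ∈ K) (y ∈ K) (_ : x ≠ y),
    ENNReal.ofReal |f x - f y| / ENNReal.ofReal (ω (dist x y))

/-- The restriction of `f` to `K` belongs to `Lip_ω(K)`. -/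
def MemLip {d : ℕ} (ω : ℝ → ℝ) (K : Set (EuclideanSpace ℝ (Fin d)))
    (f : EuclideanSpace ℝ (Fin d) → ℝ) : Prop :=
  ContinuousOn f K ∧ lipSeminorm ω K f < ∞

/-- For every `δ > 0` there is a function `G`, harmonic in the open `δ`-neighbourhood `K_δ` of `K`,
such that `|f - G| ≤ A₁ ω(δ)` on `K` and `|∇G| ≤ A₂ ω(δ) / δ` on `K_δ`. The numbers `A₁`, `A₂`
are the same for all `δ`. -/
def HarmonicallyApproximable {d : ℕ} (ω : ℝ → ℝ) (K : Set (EuclideanSpace ℝ (Fin d)))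
    (f : EuclideanSpace ℝ (Fin d) → ℝ) (A₁ A₂ : ℝ) : Prop :=
  ∀ δ : ℝ, 0 < δ → ∃ G : EuclideanSpace ℝ (Fin d) → ℝ,
    InnerProductSpace.HarmonicOnNhd G (Metric.thickening δ K) ∧
    (∀ x ∈ K, |f x - G x| ≤ A₁ * ω δ) ∧
    (∀ x ∈ Metric.thickening δ K, ‖gradient G x‖ ≤ A₂ * (ω δ / δ))

/-! That (H) implies membership in `Lip_ω` is elementary. With δ = 2|x - y| the point y lies in a
ball about x contained in K_δ, so the mean value inequality for G_δ and ω(2t) ≤ 2ω(t) bound |f(x) -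
f(y)|.

For the converse, f is extended, up to an additive constant, to a compactly supported F on the whole
space with the same modulus, and space is rescaled to δ = 1. Let A bound the oscillation of F over
unit distances. Take Φ equal to |x|^(2-d) off the unit ball and smooth inside, and put η = ΔΦ, which
lives in the unit ball and has κ = ∫η ≠ 0. The density φ = F * Δη is O(A) because Δη has mean zero,
and φ * Φ = F * η * η differs from κ²F by O(A). So κ²F is nearly a potential of a bounded density,
but its poles may lie in K_δ.

Porosity supplies, within bounded distance of every y, a point p(y) far from K_δ. The pole y is
replaced by three poles near p(y), weighted by quadratic extrapolation along the segment from p(y)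
to y. Since quadratic polynomials are reproduced exactly, the error is governed by third derivatives
of |x|^(2-d), of order |x|^(-(d+1)). This is integrable at infinity, so the new potential G₀ is
still O(A)-close to κ²F, independently of the size of the support. Finally G₀ * η is smooth,
harmonic away from the moved poles, has gradient O(A) because ∇η has mean zero, and is O(A)-close to
κ³F.

The main lemmas are `exists_regularized_fundamental_solution`,
`exists_abs_sub_extrapolate_kernel_le` and `exists_harmonic_approximation_unit_scale`. -/

section HarmonicApproximation

open MeasureTheory Laplacian ContDiff Topology

/-! ### Derivatives and Laplacians of smooth functions -/

section Calculus

variable {E : Type*} [NormedAddCommGroup E] [InnerProductSpace ℝ E]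

theorem contDiff_fderiv_apply_const {f : E → ℝ} (hf : ContDiff ℝ ∞ f) (v : E) :
    ContDiff ℝ ∞ (fun z => fderiv ℝ f z v) :=
  (hf.fderiv_right (m := ∞) (by simp)).clm_apply contDiff_const

theorem fderiv_fun_const_sub_left {f : E → ℝ} (hf : Differentiable ℝ f) (x t v : E) :
    fderiv ℝ (fun s => f (x - s)) t v = - fderiv ℝ f (x - t) v := by
  have h : HasFDerivAt (fun s => f (x - s)) ((fderiv ℝ f (x - t)).comp
      (-(ContinuousLinearMap.id ℝ E))) t :=
    (hf (x - t)).hasFDerivAt.comp t ((hasFDerivAt_id t).const_sub x)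
  rw [h.fderiv]
  simp

variable [FiniteDimensional ℝ E]

theorem laplacian_eq_sum_fderiv {ι : Type*} [Fintype ι] (b : OrthonormalBasis ι ℝ E)
    {f : E → ℝ} (hf : ContDiff ℝ 2 f) (x : E) :
    Δ f x = ∑ i, fderiv ℝ (fun z => fderiv ℝ f z (b i)) x (b i) := by
  rw [InnerProductSpace.laplacian_eq_iteratedFDeriv_orthonormalBasis f b]
  refine Finset.sum_congr rfl fun i _ => ?_
  have hd : DifferentiableAt ℝ (fderiv ℝ f) x :=
    (hf.fderiv_right (m := 1) le_rfl).differentiable one_ne_zero x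
  rw [iteratedFDeriv_two_apply, fderiv_clm_apply hd (differentiableAt_const _)]
  simp

theorem contDiff_laplacian {f : E → ℝ} (hf : ContDiff ℝ ∞ f) : ContDiff ℝ ∞ (Δ f) := by
  have : Δ f = fun x => ∑ i, fderiv ℝ (fun z => fderiv ℝ f z (stdOrthonormalBasis ℝ E i)) x
      (stdOrthonormalBasis ℝ E i) :=
    funext fun x => laplacian_eq_sum_fderiv _ (contDiff_infty.1 hf 2) x
  rw [this]
  exact ContDiff.sum fun i _ => contDiff_fderiv_apply_const (contDiff_fderiv_apply_const hf _) _

theorem hasCompactSupport_laplacian {f : E → ℝ} (hf : HasCompactSupport f) :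
    HasCompactSupport (Δ f) := by
  refine HasCompactSupport.intro hf (K := tsupport f) fun x hx => ?_
  have h0 : f =ᶠ[𝓝 x] fun _ => (0 : ℝ) := by
    rw [notMem_tsupport_iff_eventuallyEq] at hx
    exact hx
  have := InnerProductSpace.laplacian_congr_nhds h0
  rw [this.eq_of_nhds]
  simp

theorem laplacian_fun_const_sub {f : E → ℝ} (hf : ContDiff ℝ ∞ f) (x t : E) :
    Δ (fun s => f (x - s)) t = Δ f (x - t) := by
  have h2 : ContDiff ℝ 2 f := contDiff_infty.1 hf 2
  have h2' : ContDiff ℝ 2 (fun s => f (x - s)) := h2.comp (contDiff_const.sub contDiff_id)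
  rw [laplacian_eq_sum_fderiv (stdOrthonormalBasis ℝ E) h2',
    laplacian_eq_sum_fderiv (stdOrthonormalBasis ℝ E) h2]
  refine Finset.sum_congr rfl fun i _ => ?_
  have : (fun z => fderiv ℝ (fun s => f (x - s)) z (stdOrthonormalBasis ℝ E i)) =
      fun z => - (fun w => fderiv ℝ f w (stdOrthonormalBasis ℝ E i)) (x - z) :=
    funext fun z => fderiv_fun_const_sub_left (h2.differentiable two_ne_zero) x z _
  rw [this, fderiv_fun_neg, neg_apply, fderiv_fun_const_sub_left
    ((contDiff_fderiv_apply_const hf _).differentiable (by simp)), neg_neg]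

theorem laplacian_comp_smul {f : E → ℝ} (hf : ContDiff ℝ ∞ f) (c : ℝ) (x : E) :
    Δ (fun s => f (c • s)) x = c ^ 2 * Δ f (c • x) := by
  have h2 : ContDiff ℝ 2 f := contDiff_infty.1 hf 2
  have h2' : ContDiff ℝ 2 (fun s => f (c • s)) := h2.comp (contDiff_const_smul c)
  rw [laplacian_eq_sum_fderiv (stdOrthonormalBasis ℝ E) h2',
    laplacian_eq_sum_fderiv (stdOrthonormalBasis ℝ E) h2, Finset.mul_sum]
  refine Finset.sum_congr rfl fun i _ => ?_
  have : (fun z => fderiv ℝ (fun s => f (c • s)) z (stdOrthonormalBasis ℝ E i)) =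
      fun z => c • (fun w => fderiv ℝ f w (stdOrthonormalBasis ℝ E i)) (c • z) :=
    funext fun z => by rw [fderiv_comp_smul]; rfl
  have hd : Differentiable ℝ fun z =>
      (fun w => fderiv ℝ f w (stdOrthonormalBasis ℝ E i)) (c • z) :=
    ((contDiff_fderiv_apply_const hf _).comp (contDiff_const_smul c)).differentiable (by simp)
  rw [this, fderiv_fun_const_smul (hd x),
    fderiv_comp_smul (f := fun w => fderiv ℝ f w (stdOrthonormalBasis ℝ E i))]
  simp only [smul_apply, smul_eq_mul]
  ring

theorem laplacian_fun_add_const {f : E → ℝ} (hf : ContDiff ℝ ∞ f) (c : ℝ) (x : E) :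
    Δ (fun s => f s + c) x = Δ f x := by
  have h2 : ContDiff ℝ 2 f := contDiff_infty.1 hf 2
  rw [laplacian_eq_sum_fderiv (stdOrthonormalBasis ℝ E) (h2.add contDiff_const),
    laplacian_eq_sum_fderiv (stdOrthonormalBasis ℝ E) h2]
  simp only [fderiv_add_const]

theorem laplacian_radial {ψ : ℝ → ℝ} (hψ : ContDiff ℝ ∞ ψ) (x : E) :
    Δ (fun y : E => ψ (‖y‖ ^ 2)) x =
      2 * Module.finrank ℝ E * deriv ψ (‖x‖ ^ 2) + 4 * ‖x‖ ^ 2 * deriv (deriv ψ) (‖x‖ ^ 2) := by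
  have hc : ContDiff ℝ ∞ (fun y : E => ψ (‖y‖ ^ 2)) := hψ.comp (contDiff_norm_sq ℝ)
  have key : ∀ {θ : ℝ → ℝ}, Differentiable ℝ θ → ∀ y : E,
      HasFDerivAt (fun y : E => θ (‖y‖ ^ 2)) (deriv θ (‖y‖ ^ 2) • (2 • innerSL ℝ y)) y := by
    intro θ hθ y
    have h1 : HasFDerivAt (fun y : E => ‖y‖ ^ 2) (2 • innerSL ℝ y) y := by
      simpa using (hasStrictFDerivAt_norm_sq y).hasFDerivAt
    exact (hθ (‖y‖ ^ 2)).hasDerivAt.comp_hasFDerivAt y h1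
  have hψ' : ContDiff ℝ ∞ (deriv ψ) := (contDiff_infty_iff_deriv.1 hψ).2
  have hd := hψ.differentiable (by simp)
  have hd' := hψ'.differentiable (by simp)
  let b := stdOrthonormalBasis ℝ E
  rw [laplacian_eq_sum_fderiv b (contDiff_infty.1 hc 2)]
  have h1 : ∀ i, fderiv ℝ (fun z => fderiv ℝ (fun y : E => ψ (‖y‖ ^ 2)) z (b i)) x (b i) =
      2 * deriv ψ (‖x‖ ^ 2) + 4 * deriv (deriv ψ) (‖x‖ ^ 2) * (inner ℝ x (b i)) ^ 2 := by
    intro i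
    have : (fun z => fderiv ℝ (fun y : E => ψ (‖y‖ ^ 2)) z (b i)) =
        fun z => deriv ψ (‖z‖ ^ 2) * (2 * inner ℝ z (b i)) := by
      funext z
      rw [(key hd z).fderiv]
      simp [two_mul]
    rw [this]
    have hlin : HasFDerivAt (fun z : E => 2 * inner ℝ z (b i)) (2 • innerSL ℝ (b i)) x := by
      have := ((innerSL ℝ (b i)).hasFDerivAt (x := x)).const_mul 2
      refine (this.congr_fderiv ?_).congr_of_eventuallyEq (Filter.Eventually.of_forall ?_)
      · ext; simp [two_mul]
      · intro z; simp [real_inner_comm]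
    have hm := (key hd' x).mul hlin
    rw [show (fun z : E => deriv ψ (‖z‖ ^ 2) * (2 * inner ℝ z (b i))) =
      (fun z : E => deriv ψ (‖z‖ ^ 2)) * fun z => 2 * inner ℝ z (b i) from rfl, hm.fderiv]
    have hn : ‖b i‖ = 1 := b.orthonormal.1 i
    simp [hn]
    ring
  -- By Parseval the squares of the inner products sum to ‖x‖².
  rw [Finset.sum_congr rfl fun i _ => h1 i, Finset.sum_add_distrib, ← Finset.mul_sum (a := 4 * deriv (deriv ψ) (‖x‖ ^ 2)),
    b.sum_sq_inner_left x]
  simp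
  ring

end Calculus

/-! ### Integration by parts and convolution -/

section Integration

variable {E : Type*} [NormedAddCommGroup E] [InnerProductSpace ℝ E] [FiniteDimensional ℝ E]
  [MeasurableSpace E] [BorelSpace E]

theorem integral_mul_fderiv_eq_neg {u g : E → ℝ} (hu : ContDiff ℝ ∞ u) (hg : ContDiff ℝ ∞ g)
    (hgc : HasCompactSupport g) (v : E) :
    ∫ x, u x * fderiv ℝ g x v = - ∫ x, fderiv ℝ u x v * g x := by
  have hg' := (contDiff_fderiv_apply_const hg v).continuous
  have hu' := (contDiff_fderiv_apply_const hu v).continuous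
  refine integral_mul_fderiv_eq_neg_fderiv_mul_of_integrable ?_ ?_ ?_
    (fun x _ => hu.differentiable (by simp) x) (fun x _ => hg.differentiable (by simp) x)
  · exact (hu'.mul hg.continuous).integrable_of_hasCompactSupport hgc.mul_left
  · exact (hu.continuous.mul hg').integrable_of_hasCompactSupport
      (hgc.fderiv_apply ℝ v).mul_left
  · exact (hu.continuous.mul hg.continuous).integrable_of_hasCompactSupport hgc.mul_left

theorem integral_mul_laplacian {u g : E → ℝ} (hu : ContDiff ℝ ∞ u) (hg : ContDiff ℝ ∞ g)
    (hgc : HasCompactSupport g) :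
    ∫ x, u x * Δ g x = ∫ x, Δ u x * g x := by
  let b := stdOrthonormalBasis ℝ E
  have e1 : ∀ x, u x * Δ g x = ∑ i, u x * fderiv ℝ (fun z => fderiv ℝ g z (b i)) x (b i) :=
    fun x => by rw [laplacian_eq_sum_fderiv b (contDiff_infty.1 hg 2),
      Finset.mul_sum]
  have e2 : ∀ x, Δ u x * g x = ∑ i, fderiv ℝ (fun z => fderiv ℝ u z (b i)) x (b i) * g x :=
    fun x => by rw [laplacian_eq_sum_fderiv b (contDiff_infty.1 hu 2),
      Finset.sum_mul]
  simp_rw [e1, e2]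
  rw [integral_finsetSum, integral_finsetSum]
  · refine Finset.sum_congr rfl fun i _ => ?_
    rw [integral_mul_fderiv_eq_neg hu (contDiff_fderiv_apply_const hg _) (hgc.fderiv_apply ℝ _),
      integral_mul_fderiv_eq_neg (contDiff_fderiv_apply_const hu _) hg hgc, neg_neg]
  · exact fun i _ => ((contDiff_fderiv_apply_const (contDiff_fderiv_apply_const hu _)
      _).continuous.mul hg.continuous).integrable_of_hasCompactSupport hgc.mul_left
  · exact fun i _ => (hu.continuous.mul (contDiff_fderiv_apply_const
      (contDiff_fderiv_apply_const hg _) _).continuous).integrable_of_hasCompactSupport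
      ((hgc.fderiv_apply ℝ _).fderiv_apply ℝ _).mul_left

theorem integral_laplacian_eq_zero {g : E → ℝ} (hg : ContDiff ℝ ∞ g)
    (hgc : HasCompactSupport g) : ∫ x, Δ g x = 0 := by
  have := integral_mul_laplacian (u := fun _ => 1) contDiff_const hg hgc
  simpa using this

theorem integral_fderiv_apply_eq_zero {g : E → ℝ} (hg : ContDiff ℝ ∞ g)
    (hgc : HasCompactSupport g) (v : E) : ∫ x, fderiv ℝ g x v = 0 := by
  have := integral_mul_fderiv_eq_neg (u := fun _ => 1) contDiff_const hg hgc v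
  simpa using this

theorem integral_sub_mul_laplacian {u g : E → ℝ} (hu : ContDiff ℝ ∞ u) (hg : ContDiff ℝ ∞ g)
    (hgc : HasCompactSupport g) (x : E) :
    ∫ t, u (x - t) * Δ g t = ∫ t, Δ u (x - t) * g t := by
  rw [integral_mul_laplacian (u := fun t => u (x - t))
    (hu.comp (contDiff_const.sub contDiff_id)) hg hgc]
  simp_rw [laplacian_fun_const_sub hu]

/-- The convolution `∫ f t * g (x - t) dt`. -/
noncomputable def smear (f g : E → ℝ) (x : E) : ℝ := ∫ t, f t * g (x - t)

theorem smear_eq_convolution (f g : E → ℝ) :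
    smear f g = MeasureTheory.convolution f g (ContinuousLinearMap.mul ℝ ℝ) volume := by
  funext x
  simp [smear, MeasureTheory.convolution]

theorem contDiff_smear {f g : E → ℝ} (hf : LocallyIntegrable f) (hg : ContDiff ℝ ∞ g)
    (hgc : HasCompactSupport g) : ContDiff ℝ ∞ (smear f g) := by
  rw [smear_eq_convolution]
  exact hgc.contDiff_convolution_right _ hf hg

theorem fderiv_smear {f g : E → ℝ} (hf : LocallyIntegrable f) (hg : ContDiff ℝ ∞ g)
    (hgc : HasCompactSupport g) (x v : E) :
    fderiv ℝ (smear f g) x v = smear f (fun z => fderiv ℝ g z v) x := by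
  have h1 : ContDiff ℝ 1 g := contDiff_infty.1 hg 1
  have h := hgc.hasFDerivAt_convolution_right (ContinuousLinearMap.mul ℝ ℝ) hf h1 x
  rw [smear_eq_convolution, h.fderiv, convolution_precompR_apply _ hf (hgc.fderiv ℝ)
    (h1.continuous_fderiv one_ne_zero), smear_eq_convolution]

theorem laplacian_smear {f g : E → ℝ} (hf : LocallyIntegrable f) (hg : ContDiff ℝ ∞ g)
    (hgc : HasCompactSupport g) (x : E) : Δ (smear f g) x = smear f (Δ g) x := by
  let b := stdOrthonormalBasis ℝ E
  rw [laplacian_eq_sum_fderiv b (contDiff_infty.1 (contDiff_smear hf hg hgc) 2)]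
  have h1 : ∀ i, fderiv ℝ (fun z => fderiv ℝ (smear f g) z (b i)) x (b i) =
      ∫ t, f t * fderiv ℝ (fun z => fderiv ℝ g z (b i)) (x - t) (b i) := by
    intro i
    have : (fun z => fderiv ℝ (smear f g) z (b i)) = smear f (fun z => fderiv ℝ g z (b i)) :=
      funext fun z => fderiv_smear hf hg hgc z _
    rw [this, fderiv_smear hf (contDiff_fderiv_apply_const hg _) (hgc.fderiv_apply ℝ _)]
    rfl
  rw [Finset.sum_congr rfl fun i _ => h1 i, ← integral_finsetSum]
  · unfold smear
    refine integral_congr_ae (Filter.Eventually.of_forall fun t => ?_)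
    simp only
    rw [laplacian_eq_sum_fderiv b (contDiff_infty.1 hg 2), Finset.mul_sum]
  · intro i _
    have hc := ((hgc.fderiv_apply ℝ (b i)).fderiv_apply ℝ (b i)).convolutionExists_right
      (ContinuousLinearMap.mul ℝ ℝ) (f := f) (μ := volume) hf
      (contDiff_fderiv_apply_const (contDiff_fderiv_apply_const hg _) _).continuous x
    simpa [ConvolutionExistsAt] using hc

end Integration

/-! ### Radial profile and regularized fundamental solution -/

/-- A smooth monotone function which vanishes for `s ≤ 1 / 2` and equals `1` for `1 ≤ s`. -/
noncomputable def smoothStep (s : ℝ) : ℝ := Real.smoothTransition (2 * s - 1)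

theorem contDiff_smoothStep : ContDiff ℝ ∞ smoothStep :=
  Real.smoothTransition.contDiff.comp ((contDiff_const.mul contDiff_id).sub contDiff_const)

theorem smoothStep_of_le_half {s : ℝ} (hs : s ≤ 1 / 2) : smoothStep s = 0 :=
  Real.smoothTransition.zero_of_nonpos (by linarith)

theorem smoothStep_of_one_le {s : ℝ} (hs : 1 ≤ s) : smoothStep s = 1 :=
  Real.smoothTransition.one_of_one_le (by linarith)

theorem monotone_smoothStep : Monotone smoothStep := fun a b hab =>
  Real.smoothTransition.monotone (by linarith)

theorem exists_deriv_smoothStep_ne_zero : ∃ s : ℝ, 0 < s ∧ deriv smoothStep s ≠ 0 := by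
  obtain ⟨c, hc, hd⟩ := exists_deriv_eq_slope smoothStep (a := 1 / 2) (b := 1) (by norm_num)
    contDiff_smoothStep.continuous.continuousOn
    (contDiff_smoothStep.differentiable (by simp)).differentiableOn
  refine ⟨c, by linarith [hc.1], ?_⟩
  rw [hd, smoothStep_of_one_le le_rfl, smoothStep_of_le_half le_rfl]
  norm_num

/-- The power may be singular only at 0, and the cut-off vanishes identically to the left of 1/2. -/
theorem contDiff_smoothStep_mul_rpow (a : ℝ) : ContDiff ℝ ∞ fun s => smoothStep s * s ^ a := by
  rw [contDiff_iff_contDiffAt]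
  intro s
  rcases lt_or_ge s (1 / 2) with hs | hs
  · refine (contDiffAt_const (c := (0 : ℝ))).congr_of_eventuallyEq ?_
    filter_upwards [Iio_mem_nhds hs] with t ht
    rw [smoothStep_of_le_half (le_of_lt ht), zero_mul]
  · exact contDiff_smoothStep.contDiffAt.mul
      (Real.contDiffAt_rpow_const_of_ne (by linarith : s ≠ 0))

/-- The profile of a smooth modification of the fundamental solution: it is smooth on `ℝ` and
equal to `s ^ (-β)` for `1 ≤ s`. -/
noncomputable def kernelProfile (β s : ℝ) : ℝ :=
  1 - β * ∫ t in (1 : ℝ)..s, smoothStep t * t ^ (-β - 1)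

theorem deriv_kernelProfile (β : ℝ) :
    deriv (kernelProfile β) = fun s => -β * (smoothStep s * s ^ (-β - 1)) := by
  funext s
  have := (contDiff_smoothStep_mul_rpow (-β - 1)).continuous.integral_hasStrictDerivAt 1 s
  have h := (this.hasDerivAt.const_mul β).const_sub 1
  rw [show kernelProfile β = fun s => 1 - β * ∫ t in (1 : ℝ)..s, smoothStep t * t ^ (-β - 1)
    from rfl, h.deriv]
  ring

theorem contDiff_kernelProfile (β : ℝ) : ContDiff ℝ ∞ (kernelProfile β) := by
  rw [contDiff_infty_iff_deriv, deriv_kernelProfile]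
  refine ⟨fun s => ?_, contDiff_const.mul (contDiff_smoothStep_mul_rpow _)⟩
  have := (contDiff_smoothStep_mul_rpow (-β - 1)).continuous.integral_hasStrictDerivAt 1 s
  exact ((this.hasDerivAt.const_mul β).const_sub 1).differentiableAt

theorem kernelProfile_of_one_le {β : ℝ} (hβ : 0 < β) {s : ℝ} (hs : 1 ≤ s) :
    kernelProfile β s = s ^ (-β) := by
  have h : ∫ t in (1 : ℝ)..s, smoothStep t * t ^ (-β - 1) = ∫ t in (1 : ℝ)..s, t ^ (-β - 1) := by
    refine intervalIntegral.integral_congr fun t ht => ?_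
    rw [Set.uIcc_of_le hs] at ht
    rw [smoothStep_of_one_le ht.1, one_mul]
  rw [kernelProfile, h, integral_rpow]
  · rw [Real.one_rpow, show -β - 1 + 1 = -β by ring]
    field_simp
    ring
  · refine Or.inr ⟨by linarith, fun h0 => ?_⟩
    rw [Set.uIcc_of_le hs] at h0
    linarith [h0.1]

/-- For s = ‖x‖² the left side is the Laplacian of the radial function in dimension 2β + 2. The pure
power s^(-β) satisfies the homogeneous equation for s > 0, so only the derivative of the cut-off
survives. Cutting off the derivative of the profile, not the profile itself, gives the right side a
sign. -/
theorem kernelProfile_ode (β s : ℝ) :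
    2 * (2 * β + 2) * deriv (kernelProfile β) s + 4 * s * deriv (deriv (kernelProfile β)) s =
      -(4 * β * s ^ (-β) * deriv smoothStep s) := by
  rcases lt_or_ge s (1 / 2) with hs' | hs'
  · have h0 : smoothStep =ᶠ[𝓝 s] fun _ => 0 := by
      filter_upwards [Iio_mem_nhds hs'] with t ht
      exact smoothStep_of_le_half (le_of_lt ht)
    have h1 : deriv (kernelProfile β) =ᶠ[𝓝 s] fun _ => 0 := by
      filter_upwards [h0] with t ht
      rw [deriv_kernelProfile]
      simp [ht]
    rw [h1.deriv_eq, h0.deriv_eq, h1.eq_of_nhds]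
    simp
  · have hs0 : 0 < s := by linarith
    have hd := (contDiff_smoothStep.differentiable (by simp) s).hasDerivAt
    have hr := Real.hasDerivAt_rpow_const (x := s) (p := -β - 1) (Or.inl hs0.ne')
    have := (hd.mul hr).const_mul (-β)
    rw [deriv_kernelProfile]
    have e : deriv (fun s => -β * (smoothStep s * s ^ (-β - 1))) s = _ := this.deriv
    rw [e]
    have e1 : s ^ (-β) = s ^ (-β - 1) * s := by
      rw [← Real.rpow_add_one hs0.ne']; congr 1; ring
    have e2 : s ^ (-β - 1) = s ^ (-β - 1 - 1) * s := by
      rw [← Real.rpow_add_one hs0.ne']; congr 1; ring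
    beta_reduce
    rw [e1, e2]
    ring

section

variable {E : Type*} [NormedAddCommGroup E] [InnerProductSpace ℝ E] [FiniteDimensional ℝ E]
  [MeasurableSpace E] [BorelSpace E]

/-- A smooth bounded function that coincides with the fundamental solution `‖x‖ ^ (2 - dim E)` of
the Laplacian off the unit ball, and whose Laplacian has a non-zero integral. -/
theorem exists_regularized_fundamental_solution {β : ℝ} (hβ : 0 < β)
    (hdim : (Module.finrank ℝ E : ℝ) = 2 * β + 2) :
    ∃ Φ : E → ℝ, ContDiff ℝ ∞ Φ ∧ (∀ x, 1 ≤ ‖x‖ → Φ x = (‖x‖ ^ 2) ^ (-β)) ∧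
      (∃ B, ∀ x, |Φ x| ≤ B) ∧ (∀ x, 1 < ‖x‖ → Δ Φ x = 0) ∧ ∫ x, Δ Φ x ≠ 0 := by
  let Φ : E → ℝ := fun x => kernelProfile β (‖x‖ ^ 2)
  have hΦ : ContDiff ℝ ∞ Φ := (contDiff_kernelProfile β).comp (contDiff_norm_sq ℝ)
  have hout : ∀ x, 1 ≤ ‖x‖ → Φ x = (‖x‖ ^ 2) ^ (-β) := fun x hx =>
    kernelProfile_of_one_le hβ (one_le_pow₀ hx)
  have hlap : ∀ x, Δ Φ x = -(4 * β * (‖x‖ ^ 2) ^ (-β) * deriv smoothStep (‖x‖ ^ 2)) := by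
    intro x
    rw [← kernelProfile_ode β, laplacian_radial (contDiff_kernelProfile β) x, hdim]
  have hzero : ∀ x, 1 < ‖x‖ → Δ Φ x = 0 := by
    intro x hx
    have h0 : smoothStep =ᶠ[𝓝 (‖x‖ ^ 2)] fun _ => 1 := by
      filter_upwards [Ioi_mem_nhds (one_lt_pow₀ hx two_ne_zero)] with t ht
      exact smoothStep_of_one_le (le_of_lt ht)
    rw [hlap, h0.deriv_eq]
    simp
  refine ⟨Φ, hΦ, hout, ?_, hzero, ?_⟩
  · obtain ⟨B, hB⟩ := (isCompact_closedBall (0 : E) 1).exists_bound_of_continuousOn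
      hΦ.continuous.continuousOn
    refine ⟨max B 1, fun x => ?_⟩
    rcases le_or_gt ‖x‖ 1 with hx | hx
    · exact (hB x (by simpa using hx)).trans (le_max_left _ _)
    · rw [hout x hx.le, abs_of_nonneg (by positivity)]
      exact (Real.rpow_le_one_of_one_le_of_nonpos (one_le_pow₀ hx.le) (by linarith)).trans
        (le_max_right _ _)
  -- -ΔΦ is continuous and nonnegative, and it does not vanish on the sphere ‖x‖² = s; hence its
  -- integral is positive.
  · obtain ⟨s, hs, hds⟩ := exists_deriv_smoothStep_ne_zero
    have : Nontrivial E := by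
      refine Module.nontrivial_of_finrank_pos (R := ℝ) ?_
      have : (0 : ℝ) < Module.finrank ℝ E := by linarith
      exact_mod_cast this
    obtain ⟨x, hx⟩ := exists_norm_eq E (Real.sqrt_nonneg s)
    have hpos : 0 < ∫ x, (-Δ Φ) x := by
      refine Continuous.integral_pos_of_hasCompactSupport_nonneg_nonzero (x := x)
        (contDiff_laplacian hΦ).continuous.neg ?_ ?_ ?_
      · refine HasCompactSupport.intro (isCompact_closedBall (0 : E) 1) fun y hy => ?_
        simp [hzero y (by simpa using hy)]
      · intro y
        have := monotone_smoothStep.deriv_nonneg (x := ‖y‖ ^ 2)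
        simp only [Pi.zero_apply, Pi.neg_apply, hlap, neg_neg]
        positivity
      · rw [Pi.neg_apply, hlap, neg_neg, hx, Real.sq_sqrt hs.le]
        have := Real.rpow_pos_of_pos hs (-β)
        exact mul_ne_zero (by positivity) hds
    intro h
    simp [integral_neg, h] at hpos

end

/-! ### Quadratic extrapolation and decay of the extrapolated kernel -/

/-- Quadratic extrapolation to the point `1` from the nodes `0`, `τ`, `2 * τ`. -/
noncomputable def extrapolate (τ : ℝ) (g : ℝ → ℝ) : ℝ :=
  (1 - τ) * (1 - 2 * τ) / (2 * τ ^ 2) * g 0 + (-(1 - 2 * τ) / τ ^ 2) * g τ +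
    (1 - τ) / (2 * τ ^ 2) * g (2 * τ)

/-- A bound for the norm of `g ↦ g 1 - extrapolate τ g`. -/
noncomputable def extrapolateBound (τ : ℝ) : ℝ :=
  1 + |(1 - τ) * (1 - 2 * τ) / (2 * τ ^ 2)| + |-(1 - 2 * τ) / τ ^ 2| + |(1 - τ) / (2 * τ ^ 2)|

theorem extrapolateBound_pos (τ : ℝ) : 0 < extrapolateBound τ := by
  unfold extrapolateBound; positivity

theorem abs_sub_extrapolate_le {τ M : ℝ} {g : ℝ → ℝ} (h0 : |g 0| ≤ M) (h1 : |g τ| ≤ M)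
    (h2 : |g (2 * τ)| ≤ M) (h3 : |g 1| ≤ M) :
    |g 1 - extrapolate τ g| ≤ extrapolateBound τ * M := by
  unfold extrapolate extrapolateBound
  set a := (1 - τ) * (1 - 2 * τ) / (2 * τ ^ 2)
  set b := -(1 - 2 * τ) / τ ^ 2
  set c := (1 - τ) / (2 * τ ^ 2)
  calc |g 1 - (a * g 0 + b * g τ + c * g (2 * τ))|
      ≤ |g 1| + (|a * g 0| + |b * g τ| + |c * g (2 * τ)|) :=
        (abs_sub _ _).trans (add_le_add_right ((abs_add_le _ _).trans
          (add_le_add_left (abs_add_le _ _) _)) _)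
    _ = |g 1| + (|a| * |g 0| + |b| * |g τ| + |c| * |g (2 * τ)|) := by simp only [abs_mul]
    _ ≤ M + (|a| * M + |b| * M + |c| * M) := by gcongr
    _ = (1 + |a| + |b| + |c|) * M := by ring

theorem extrapolate_add (τ : ℝ) (g h : ℝ → ℝ) :
    extrapolate τ (fun s => g s + h s) = extrapolate τ g + extrapolate τ h := by
  unfold extrapolate; ring

theorem extrapolate_quadratic {τ : ℝ} (hτ : τ ≠ 0) (a b c : ℝ) :
    extrapolate τ (fun s => a + b * s + c * s ^ 2) = a + b + c := by
  unfold extrapolate; field_simp; ring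

/-- Extrapolation reproduces the second Taylor polynomial at 0, so only the Taylor remainder
contributes. Three applications of the mean value inequality bound that remainder by M on [0, 1]. -/
theorem abs_sub_extrapolate_le_of_deriv_three {τ M : ℝ} (hτ : 0 < τ) (hτ' : 2 * τ ≤ 1)
    {g g₁ g₂ g₃ : ℝ → ℝ} (h0 : ∀ s ∈ Set.Icc (0 : ℝ) 1, HasDerivAt g (g₁ s) s)
    (h1 : ∀ s ∈ Set.Icc (0 : ℝ) 1, HasDerivAt g₁ (g₂ s) s)
    (h2 : ∀ s ∈ Set.Icc (0 : ℝ) 1, HasDerivAt g₂ (g₃ s) s)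
    (h3 : ∀ s ∈ Set.Icc (0 : ℝ) 1, |g₃ s| ≤ M) :
    |g 1 - extrapolate τ g| ≤ extrapolateBound τ * M := by
  have key : ∀ {u u' : ℝ → ℝ}, (∀ s ∈ Set.Icc (0 : ℝ) 1, HasDerivAt u (u' s) s) →
      (∀ s ∈ Set.Icc (0 : ℝ) 1, |u' s| ≤ M) → u 0 = 0 → ∀ s ∈ Set.Icc (0 : ℝ) 1, |u s| ≤ M := by
    intro u u' hu hu' hu0 s hs
    have hM : 0 ≤ M := (abs_nonneg _).trans (hu' s hs)
    have := (convex_Icc (0 : ℝ) 1).norm_image_sub_le_of_norm_hasDerivWithin_le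
      (fun t ht => (hu t ht).hasDerivWithinAt) hu' (Set.left_mem_Icc.2 zero_le_one) hs
    rw [hu0, sub_zero, sub_zero, Real.norm_eq_abs, Real.norm_eq_abs] at this
    refine this.trans (mul_le_of_le_one_right hM ?_)
    rw [abs_of_nonneg hs.1]; exact hs.2
  have k2 := key (u := fun s => g₂ s - g₂ 0) (fun s hs => (h2 s hs).sub_const _) h3 (by simp)
  have k1 := key (u := fun s => g₁ s - g₁ 0 - g₂ 0 * s) (u' := fun s => g₂ s - g₂ 0)
    (fun s hs => by
      have := ((h1 s hs).sub_const (g₁ 0)).sub ((hasDerivAt_id s).const_mul (g₂ 0))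
      exact this.congr_deriv (by simp)) k2 (by simp)
  have k0 := key (u := fun s => g s + (- g 0 + (-g₁ 0) * s + (- (g₂ 0 / 2)) * s ^ 2))
    (u' := fun s => g₁ s - g₁ 0 - g₂ 0 * s)
    (fun s hs => by
      have := (h0 s hs).add (((hasDerivAt_const s (- g 0)).add
        ((hasDerivAt_id s).const_mul (-g₁ 0))).add
        ((hasDerivAt_pow 2 s).const_mul (- (g₂ 0 / 2))))
      refine this.congr_deriv ?_
      simp; ring) k1 (by simp)
  have := abs_sub_extrapolate_le (τ := τ)
    (g := fun s => g s + (- g 0 + (-g₁ 0) * s + (- (g₂ 0 / 2)) * s ^ 2)) (k0 0 ⟨le_rfl, zero_le_one⟩)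
    (k0 τ ⟨hτ.le, by linarith⟩) (k0 (2 * τ) ⟨by linarith, hτ'⟩) (k0 1 ⟨zero_le_one, le_rfl⟩)
  rw [extrapolate_add, extrapolate_quadratic hτ.ne'] at this
  convert this using 2
  ring

/-- The expression is the third derivative of q(s)^(-β) when q is quadratic with q' = p and q'' =
2c. Both terms scale like N^(-(2β+3)). -/
theorem abs_rpow_quadratic_deriv_three_le {β N q p c R : ℝ} (hβ : 0 < β) (hN : 0 < N)
    (hq : q = N ^ 2) (_hR : 0 ≤ R) (hc : 0 ≤ c) (hcR : c ≤ R ^ 2) (hp : |p| ≤ 2 * N * R) :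
    |-(β * (β + 1) * (β + 2)) * q ^ (-β - 3) * p ^ 3 + 6 * c * (β * (β + 1)) * q ^ (-β - 2) * p|
      ≤ (8 * (β * (β + 1) * (β + 2)) + 12 * (β * (β + 1))) * R ^ 3 * N ^ (-(2 * β + 3)) := by
  have e3 : q ^ (-β - 3) * N ^ 3 = N ^ (-(2 * β + 3)) := by
    rw [hq, ← Real.rpow_natCast N 2, ← Real.rpow_mul hN.le, ← Real.rpow_natCast N 3,
      ← Real.rpow_add hN]
    congr 1; push_cast; ring
  have e2 : q ^ (-β - 2) * N = N ^ (-(2 * β + 3)) := by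
    rw [hq, ← Real.rpow_natCast N 2, ← Real.rpow_mul hN.le, ← Real.rpow_add_one hN.ne']
    congr 1; push_cast; ring
  have hq0 : 0 < q := by rw [hq]; positivity
  have a3 := Real.rpow_pos_of_pos hq0 (-β - 3)
  have a2 := Real.rpow_pos_of_pos hq0 (-β - 2)
  refine (abs_add_le _ _).trans ?_
  rw [abs_mul, abs_mul, abs_neg, abs_mul (6 * c * (β * (β + 1)) * q ^ (-β - 2)), abs_pow,
    abs_of_pos a3, abs_of_pos (by positivity : 0 < β * (β + 1) * (β + 2)),
    abs_of_nonneg (by positivity : 0 ≤ 6 * c * (β * (β + 1)) * q ^ (-β - 2))]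
  calc _ ≤ β * (β + 1) * (β + 2) * q ^ (-β - 3) * (2 * N * R) ^ 3 +
        6 * R ^ 2 * (β * (β + 1)) * q ^ (-β - 2) * (2 * N * R) := by gcongr
    _ = 8 * (β * (β + 1) * (β + 2)) * R ^ 3 * (q ^ (-β - 3) * N ^ 3) +
        12 * (β * (β + 1)) * R ^ 3 * (q ^ (-β - 2) * N) := by ring
    _ = _ := by rw [e3, e2]; ring

section

variable {E : Type*} [NormedAddCommGroup E] [InnerProductSpace ℝ E]

theorem abs_sub_extrapolate_kernel_le {Φ : E → ℝ} {β : ℝ} (hβ : 0 < β)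
    (hΦ : ∀ x, 1 ≤ ‖x‖ → Φ x = (‖x‖ ^ 2) ^ (-β)) {τ R ρ : ℝ} (hτ : 0 < τ) (hτ' : 2 * τ ≤ 1)
    {z v : E} (hv : ‖v‖ ≤ R) (hρ : 1 ≤ ρ) (hz : ρ + R ≤ ‖z‖) :
    |Φ (z - v) - extrapolate τ (fun s => Φ (z - s • v))| ≤
      extrapolateBound τ * ((8 * (β * (β + 1) * (β + 2)) + 12 * (β * (β + 1))) * R ^ 3 *
        ρ ^ (-(2 * β + 3))) := by
  have hR : 0 ≤ R := (norm_nonneg v).trans hv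
  set q : ℝ → ℝ := fun s => ‖z - s • v‖ ^ 2 with hq
  set p : ℝ → ℝ := fun s => -2 * inner ℝ z v + 2 * ‖v‖ ^ 2 * s with hp
  have hqe : ∀ s, q s = ‖z‖ ^ 2 + (-2 * inner ℝ z v) * s + ‖v‖ ^ 2 * s ^ 2 := by
    intro s
    simp only [hq, norm_sub_sq_real, inner_smul_right, norm_smul, mul_pow, Real.norm_eq_abs,
      sq_abs]
    ring
  have hpe : ∀ s, p s = -2 * inner ℝ (z - s • v) v := by
    intro s
    simp only [hp, inner_sub_left, real_inner_smul_left, real_inner_self_eq_norm_sq]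
    ring
  have hlow : ∀ s ∈ Set.Icc (0 : ℝ) 1, ρ ≤ ‖z - s • v‖ := by
    intro s hs
    have h1 : ‖s • v‖ ≤ R := by
      rw [norm_smul, Real.norm_of_nonneg hs.1]
      exact (mul_le_of_le_one_left (norm_nonneg _) hs.2).trans hv
    have := norm_sub_norm_le z (s • v)
    linarith
  have hqpos : ∀ s ∈ Set.Icc (0 : ℝ) 1, 0 < q s := fun s hs => by
    have := hlow s hs
    simp only [hq]
    have : 0 < ‖z - s • v‖ := by linarith
    positivity
  have dq : ∀ s, HasDerivAt q (p s) s := by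
    intro s
    rw [show q = fun s => ‖z‖ ^ 2 + (-2 * inner ℝ z v) * s + ‖v‖ ^ 2 * s ^ 2 from funext hqe]
    have := ((hasDerivAt_const s (‖z‖ ^ 2)).add ((hasDerivAt_id s).const_mul
      (-2 * inner ℝ z v))).add ((hasDerivAt_pow 2 s).const_mul (‖v‖ ^ 2))
    refine this.congr_deriv ?_
    simp [hp]; ring
  have dp : ∀ s, HasDerivAt p (2 * ‖v‖ ^ 2) s := by
    intro s
    have := ((hasDerivAt_id s).const_mul (2 * ‖v‖ ^ 2)).const_add (-2 * inner ℝ z v)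
    exact this.congr_deriv (by simp)
  have dr : ∀ s ∈ Set.Icc (0 : ℝ) 1, ∀ a : ℝ,
      HasDerivAt (fun s => q s ^ a) (p s * a * q s ^ (a - 1)) s := fun s hs a =>
    (dq s).rpow_const (Or.inl (hqpos s hs).ne')
  have hg : extrapolate τ (fun s => Φ (z - s • v)) = extrapolate τ (fun s => q s ^ (-β)) := by
    have : ∀ s ∈ Set.Icc (0 : ℝ) 1, Φ (z - s • v) = q s ^ (-β) := fun s hs =>
      hΦ _ (hρ.trans (hlow s hs))
    simp only [extrapolate]
    rw [this 0 ⟨le_rfl, zero_le_one⟩, this τ ⟨hτ.le, by linarith⟩, this (2 * τ) ⟨by linarith, hτ'⟩]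
  have h1 : Φ (z - v) = q 1 ^ (-β) := by
    have := hΦ (z - (1 : ℝ) • v) (hρ.trans (hlow 1 ⟨zero_le_one, le_rfl⟩))
    simpa [hq] using this
  rw [hg, h1]
  refine abs_sub_extrapolate_le_of_deriv_three hτ hτ'
    (g := fun s => q s ^ (-β))
    (g₁ := fun s => -β * (q s ^ (-β - 1) * p s))
    (g₂ := fun s => β * (β + 1) * (q s ^ (-β - 2) * p s ^ 2) - 2 * ‖v‖ ^ 2 * β * q s ^ (-β - 1))
    (g₃ := fun s => -(β * (β + 1) * (β + 2)) * q s ^ (-β - 3) * p s ^ 3 +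
      6 * ‖v‖ ^ 2 * (β * (β + 1)) * q s ^ (-β - 2) * p s) ?_ ?_ ?_ ?_
  · intro s hs
    exact (dr s hs (-β)).congr_deriv (by ring)
  · intro s hs
    refine (((dr s hs (-β - 1)).mul (dp s)).const_mul (-β)).congr_deriv ?_
    rw [show -β - 1 - 1 = -β - 2 by ring]; ring
  · intro s hs
    refine ((((dr s hs (-β - 2)).mul ((dp s).pow 2)).const_mul (β * (β + 1))).sub
      ((dr s hs (-β - 1)).const_mul (2 * ‖v‖ ^ 2 * β))).congr_deriv ?_
    rw [show -β - 1 - 1 = -β - 2 by ring, show -β - 2 - 1 = -β - 3 by ring]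
    simp only [Nat.cast_ofNat, Nat.add_one_sub_one, pow_one, Pi.pow_apply]
    ring
  · intro s hs
    have hN : 0 < ‖z - s • v‖ := by linarith [hlow s hs]
    refine (abs_rpow_quadratic_deriv_three_le hβ hN rfl hR (by positivity) (by gcongr) ?_).trans ?_
    · rw [hpe, abs_mul, abs_neg, abs_two, mul_assoc]
      gcongr
      exact (abs_real_inner_le_norm _ _).trans (by gcongr)
    · have := Real.rpow_le_rpow_of_nonpos (by linarith) (hlow s hs)
        (by linarith : -(2 * β + 3) ≤ 0)
      gcongr

theorem exists_abs_sub_extrapolate_kernel_le {Φ : E → ℝ} {β B : ℝ} (hβ : 0 < β)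
    (hΦ : ∀ x, 1 ≤ ‖x‖ → Φ x = (‖x‖ ^ 2) ^ (-β)) (hB : ∀ x, |Φ x| ≤ B) {τ R : ℝ} (hτ : 0 < τ)
    (hτ' : 2 * τ ≤ 1) (hR : 0 ≤ R) :
    ∃ C, 0 ≤ C ∧ ∀ z v : E, ‖v‖ ≤ R →
      |Φ (z - v) - extrapolate τ (fun s => Φ (z - s • v))| ≤
        C * (1 + ‖z - v‖) ^ (-(2 * β + 3)) := by
  -- C₁ covers ‖z‖ < 2R + 2, where boundedness of Φ suffices; C₂ covers larger ‖z‖, where ‖z‖ - R is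
  -- at least (1 + ‖z - v‖) / 3.
  set C₁ := extrapolateBound τ * B * (3 * R + 3) ^ (2 * β + 3) with hC₁
  set C₂ := extrapolateBound τ * ((8 * (β * (β + 1) * (β + 2)) + 12 * (β * (β + 1))) * R ^ 3 *
    (1 / 3) ^ (-(2 * β + 3))) with hC₂
  have hB0 : 0 ≤ B := (abs_nonneg _).trans (hB 0)
  have hE := extrapolateBound_pos τ
  have h1 : 0 ≤ C₁ := by positivity
  have h2 : 0 ≤ C₂ := by positivity
  refine ⟨C₁ + C₂, by positivity, fun z v hv => ?_⟩
  have hpos : 0 < 1 + ‖z - v‖ := by positivity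
  have hpow := Real.rpow_pos_of_pos hpos (-(2 * β + 3))
  rcases le_or_gt (2 * R + 2) ‖z‖ with hz | hz
  · refine (abs_sub_extrapolate_kernel_le hβ hΦ hτ hτ' hv (ρ := ‖z‖ - R) (by linarith)
      (by linarith)).trans ?_
    have hle : (‖z‖ - R) ^ (-(2 * β + 3)) ≤
        (1 / 3) ^ (-(2 * β + 3)) * (1 + ‖z - v‖) ^ (-(2 * β + 3)) := by
      rw [← Real.mul_rpow (by norm_num) hpos.le]
      refine Real.rpow_le_rpow_of_nonpos (by positivity) ?_ (by linarith)
      have := norm_sub_le z v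
      linarith
    calc _ ≤ extrapolateBound τ * ((8 * (β * (β + 1) * (β + 2)) + 12 * (β * (β + 1))) * R ^ 3 *
          ((1 / 3) ^ (-(2 * β + 3)) * (1 + ‖z - v‖) ^ (-(2 * β + 3)))) := by gcongr
      _ = C₂ * (1 + ‖z - v‖) ^ (-(2 * β + 3)) := by rw [hC₂]; ring
      _ ≤ _ := by gcongr; linarith
  · have h3 := abs_sub_extrapolate_le (τ := τ) (M := B) (g := fun s => Φ (z - s • v)) (hB _) (hB _)
      (hB _) (hB _)
    rw [one_smul] at h3
    refine h3.trans ?_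
    have hle : 1 ≤ (3 * R + 3) ^ (2 * β + 3) * (1 + ‖z - v‖) ^ (-(2 * β + 3)) := by
      rw [Real.rpow_neg hpos.le, ← div_eq_mul_inv, le_div_iff₀ (by positivity), one_mul]
      refine Real.rpow_le_rpow hpos.le ?_ (by linarith)
      have := norm_sub_le z v
      linarith
    calc extrapolateBound τ * B = extrapolateBound τ * B * 1 := (mul_one _).symm
      _ ≤ extrapolateBound τ * B *
          ((3 * R + 3) ^ (2 * β + 3) * (1 + ‖z - v‖) ^ (-(2 * β + 3))) := by gcongr
      _ = C₁ * (1 + ‖z - v‖) ^ (-(2 * β + 3)) := by rw [hC₁]; ring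
      _ ≤ _ := by gcongr; linarith

end

/-! ### Convolution estimates and exchange of integrals -/

section

variable {E : Type*} [NormedAddCommGroup E] [InnerProductSpace ℝ E] [FiniteDimensional ℝ E]
  [MeasurableSpace E] [BorelSpace E]

/-- Only values of u within r of x enter the integral. When g has mean zero the term with c
disappears, and the oscillation of u alone bounds the convolution. -/
theorem abs_smear_sub_le {u g : E → ℝ} (hu : Continuous u) (hg : Continuous g) {r : ℝ}
    (hr : ∀ x, r < ‖x‖ → g x = 0) {x : E} {c D : ℝ} (hD : ∀ t, dist t x ≤ r → |u t - c| ≤ D) :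
    |smear u g x - c * ∫ t, g t| ≤ D * ∫ t, |g t| := by
  have hgc : HasCompactSupport g := HasCompactSupport.intro (isCompact_closedBall (0 : E) r)
    fun y hy => hr y (by simpa using hy)
  have hgc' : HasCompactSupport fun t => g (x - t) :=
    hgc.comp_homeomorph (Homeomorph.subLeft x)
  have hg' : Continuous fun t => g (x - t) := hg.comp (continuous_const.sub continuous_id)
  have i1 : Integrable fun t => u t * g (x - t) :=
    (hu.mul hg').integrable_of_hasCompactSupport hgc'.mul_left
  have i2 : Integrable fun t => g (x - t) := hg'.integrable_of_hasCompactSupport hgc'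
  have e1 : ∫ t, g t = ∫ t, g (x - t) := (integral_sub_left_eq_self g volume x).symm
  have e2 : ∫ t, |g t| = ∫ t, |g (x - t)| :=
    (integral_sub_left_eq_self (fun t => |g t|) volume x).symm
  rw [smear, e1, e2, ← integral_const_mul, ← integral_sub i1 (i2.const_mul c),
    ← integral_const_mul]
  refine norm_integral_le_of_norm_le (f := fun t => u t * g (x - t) - c * g (x - t))
    (i2.abs.const_mul D) (Filter.Eventually.of_forall fun t => ?_)
  rw [← sub_mul, norm_mul, Real.norm_eq_abs, Real.norm_eq_abs]
  rcases lt_or_ge r ‖x - t‖ with h | h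
  · simp [hr _ h]
  · refine mul_le_mul_of_nonneg_right (hD t ?_) (abs_nonneg _)
    rwa [dist_comm, dist_eq_norm]

theorem smear_self_eq_zero {g : E → ℝ} (hr : ∀ x, 1 < ‖x‖ → g x = 0) {x : E} (hx : 2 < ‖x‖) :
    smear g g x = 0 := by
  rw [smear]
  refine integral_eq_zero_of_ae (Filter.Eventually.of_forall fun t => ?_)
  rcases lt_or_ge 1 ‖t‖ with h | h
  · simp [hr t h]
  · have : 1 < ‖x - t‖ := by linarith [norm_sub_norm_le x t]
    simp [hr _ this]

theorem integral_smear_self {g : E → ℝ} (hg : Integrable g) :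
    ∫ x, smear g g x = (∫ x, g x) ^ 2 := by
  rw [smear_eq_convolution, integral_convolution _ hg hg]
  simp [pow_two]

/-- Associativity of convolution, by Fubini and a translation; compact supports give integrability.
-/
theorem integral_smear_mul_sub {f g k : E → ℝ} (hf : Continuous f) (hfc : HasCompactSupport f)
    (hg : Continuous g) (hgc : HasCompactSupport g) (hk : Continuous k) (x : E) :
    ∫ y, smear f g y * k (x - y) = ∫ t, f t * ∫ s, k (x - t - s) * g s := by
  have h1 : ∀ y, smear f g y * k (x - y) = ∫ t, f t * g (y - t) * k (x - y) := fun y => by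
    rw [smear, integral_mul_const]
  have h2 : ∀ t, f t * ∫ s, k (x - t - s) * g s = ∫ y, f t * g (y - t) * k (x - y) := fun t => by
    rw [← integral_const_mul, ← integral_sub_right_eq_self _ t]
    refine integral_congr_ae (Filter.Eventually.of_forall fun y => ?_)
    simp only [sub_sub, add_sub_cancel]
    ring
  simp_rw [h1, h2]
  refine integral_integral_swap_of_hasCompactSupport (f := fun y t => f t * g (y - t) * k (x - y))
    (by simp only [Function.uncurry_def]; fun_prop) ?_
  refine HasCompactSupport.intro ((hfc.isCompact.add hgc.isCompact).prod hfc.isCompact) ?_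
  rintro ⟨y, t⟩ h
  simp only [Function.uncurry_apply_pair]
  by_cases ht : t ∈ tsupport f
  · have : y - t ∉ tsupport g := fun hy => h ⟨⟨t, ht, y - t, hy, by simp⟩, ht⟩
    simp [image_eq_zero_of_notMem_tsupport this]
  · simp [image_eq_zero_of_notMem_tsupport ht]

theorem smear_integral_swap {φ g : E → ℝ} {T : E → E → ℝ} {B : ℝ} (hφ : Integrable φ)
    (hg : Integrable g) (hT : Measurable (Function.uncurry T)) (hB : ∀ x y, |T x y| ≤ B) (x : E) :
    smear (fun t => ∫ y, φ y * T t y) g x = ∫ y, φ y * ∫ t, T t y * g (x - t) := by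
  have h1 : ∀ t, (∫ y, φ y * T t y) * g (x - t) = ∫ y, φ y * T t y * g (x - t) := fun t =>
    (integral_mul_const _ _).symm
  have h2 : ∀ y, φ y * ∫ t, T t y * g (x - t) = ∫ t, φ y * T t y * g (x - t) := fun y => by
    rw [← integral_const_mul]
    simp only [mul_assoc]
  simp_rw [smear, h1, h2]
  refine integral_integral_swap ?_
  have i1 : Integrable (fun z : E × E => g (x - z.1) * φ z.2) (volume.prod volume) :=
    (hg.comp_sub_left x).mul_prod hφ
  have i2 := i1.bdd_mul (c := B) (f := Function.uncurry T) hT.aestronglyMeasurable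
    (Filter.Eventually.of_forall fun z => hB _ _)
  refine i2.congr (Filter.Eventually.of_forall fun z => ?_)
  simp only [Function.uncurry]
  ring

theorem continuous_integral_mul {φ : E → ℝ} {T : E → E → ℝ} {B : ℝ} (hφ : Integrable φ)
    (hT : ∀ x, Measurable (T x)) (hT' : ∀ y, Continuous fun x => T x y)
    (hB : ∀ x y, |T x y| ≤ B) : Continuous fun t => ∫ y, φ y * T t y := by
  refine continuous_of_dominated (bound := fun y => |φ y| * B) (fun x => ?_) (fun x => ?_)
    (hφ.abs.mul_const B) (Filter.Eventually.of_forall fun y => continuous_const.mul (hT' y))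
  · exact hφ.aestronglyMeasurable.mul (hT x).aestronglyMeasurable
  · refine Filter.Eventually.of_forall fun y => ?_
    rw [norm_mul]
    exact mul_le_mul_of_nonneg_left (hB x y) (norm_nonneg _)

end

/-- Rounding y to the first point of a dense sequence within distance 1 makes the choice depend
measurably on y, as only countably many values occur. The rounding costs the extra 1 in the radius.
-/
theorem exists_measurable_selection {E : Type*} [PseudoMetricSpace E] [TopologicalSpace.SeparableSpace E]
    [MeasurableSpace E] [OpensMeasurableSpace E] {R : ℝ} {Q : E → Prop}
    (h : ∀ x, ∃ p, dist x p ≤ R ∧ Q p) :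
    ∃ p : E → E, Measurable p ∧ ∀ y, dist y (p y) ≤ R + 1 ∧ Q (p y) := by
  classical
  rcases isEmpty_or_nonempty E with hE | hE
  · exact ⟨id, measurable_id, fun y => hE.elim y⟩
  choose q hq hQ using h
  let s := TopologicalSpace.denseSeq E
  have hs : ∀ y, ∃ n, dist y (s n) < 1 := fun y =>
    (TopologicalSpace.denseRange_denseSeq E).exists_dist_lt y one_pos
  refine ⟨fun y => q (s (Nat.find (hs y))), ?_, fun y => ⟨?_, hQ _⟩⟩
  · exact (measurable_of_countable (fun n => q (s n))).comp
      (measurable_find hs fun n => measurableSet_lt (measurable_id.dist measurable_const)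
        measurable_const)
  · have h1 := Nat.find_spec (hs y)
    have h2 := hq (s (Nat.find (hs y)))
    have := dist_triangle y (s (Nat.find (hs y))) (q (s (Nat.find (hs y))))
    linarith

/-! ### Moving the poles into the holes; approximation at unit scale -/

section

variable {E : Type*} [NormedAddCommGroup E] [InnerProductSpace ℝ E]

/-- The point of the segment from `p y` to `y` with parameter `s`. -/
def towards (p : E → E) (s : ℝ) (y : E) : E := p y + s • (y - p y)

/-- The kernel extrapolated from the poles `towards p s y`, `s = 0, τ, 2 * τ`. -/
noncomputable def extrapolatedKernel (Φ : E → ℝ) (τ : ℝ) (p : E → E) (x y : E) : ℝ :=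
  extrapolate τ fun s => Φ (x - towards p s y)

theorem continuous_extrapolatedKernel {Φ : E → ℝ} (hΦ : Continuous Φ) (τ : ℝ) (p : E → E) (y : E) :
    Continuous fun x => extrapolatedKernel Φ τ p x y := by
  simp only [extrapolatedKernel, extrapolate]
  fun_prop

theorem abs_extrapolatedKernel_le {Φ : E → ℝ} {B : ℝ} (hB : ∀ x, |Φ x| ≤ B) (τ : ℝ) (p : E → E)
    (x y : E) : |extrapolatedKernel Φ τ p x y| ≤ extrapolateBound τ * B + B := by
  have h := abs_sub_extrapolate_le (τ := τ) (M := B) (g := fun s => Φ (x - towards p s y))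
    (hB _) (hB _) (hB _) (hB _)
  have h1 := hB (x - towards p 1 y)
  have : extrapolatedKernel Φ τ p x y = Φ (x - towards p 1 y) -
    (Φ (x - towards p 1 y) - extrapolate τ fun s => Φ (x - towards p s y)) := by
      rw [sub_sub_cancel]; rfl
  rw [this]
  exact (abs_sub _ _).trans (by linarith)

variable [FiniteDimensional ℝ E] [MeasurableSpace E] [BorelSpace E]

theorem measurable_extrapolatedKernel {Φ : E → ℝ} (hΦ : Continuous Φ) (τ : ℝ) {p : E → E}
    (hp : Measurable p) : Measurable (Function.uncurry (extrapolatedKernel Φ τ p)) := by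
  have hm := hΦ.measurable
  simp only [Function.uncurry_def, extrapolatedKernel, extrapolate, towards]
  fun_prop

/-- Moving the Laplacian from g to Φ leaves, for each pole, the convolution of ΔΦ and g at x minus
the pole. Both factors are supported in the unit ball, so it vanishes once the distance exceeds 2.
-/
theorem integral_extrapolatedKernel_mul_laplacian_eq_zero {Φ g : E → ℝ} (hΦ : ContDiff ℝ ∞ Φ)
    (hΦ' : ∀ x, 1 < ‖x‖ → Δ Φ x = 0) (hg : ContDiff ℝ ∞ g) (hg' : ∀ x, 1 < ‖x‖ → g x = 0)
    {τ : ℝ} {p : E → E} {x y : E} (h : ∀ s ∈ ({0, τ, 2 * τ} : Set ℝ), 2 < dist x (towards p s y)) :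
    ∫ t, extrapolatedKernel Φ τ p t y * Δ g (x - t) = 0 := by
  have hgc : HasCompactSupport g := HasCompactSupport.intro (isCompact_closedBall (0 : E) 1)
    fun y hy => hg' y (by simpa using hy)
  have hgl := (contDiff_laplacian hg).continuous
  have hi : ∀ w, Integrable fun t => Φ (t - w) * Δ g (x - t) := fun w => by
    refine Continuous.integrable_of_hasCompactSupport ?_ ?_
    · have := hΦ.continuous
      fun_prop
    · exact HasCompactSupport.mul_left
        ((hasCompactSupport_laplacian hgc).comp_homeomorph (Homeomorph.subLeft x))
  have hz : ∀ s ∈ ({0, τ, 2 * τ} : Set ℝ), ∫ t, Φ (t - towards p s y) * Δ g (x - t) = 0 := by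
    intro s hs
    rw [← integral_sub_left_eq_self _ volume x]
    simp only [sub_sub_cancel]
    have e : ∀ t, x - t - towards p s y = (x - towards p s y) - t := fun t => sub_right_comm _ _ _
    simp_rw [e]
    rw [integral_sub_mul_laplacian hΦ hg hgc]
    refine integral_eq_zero_of_ae (Filter.Eventually.of_forall fun t => ?_)
    rcases lt_or_ge 1 ‖t‖ with h1 | h1
    · simp [hg' t h1]
    · have h2 := h s hs
      rw [dist_eq_norm] at h2
      have : 1 < ‖x - towards p s y - t‖ := by
        linarith [norm_sub_norm_le (x - towards p s y) t]
      simp [hΦ' _ this]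
  simp only [extrapolatedKernel, extrapolate, add_mul, mul_assoc]
  rw [integral_add, integral_add, integral_const_mul, integral_const_mul, integral_const_mul,
    hz 0 (by simp), hz τ (by simp), hz (2 * τ) (by simp)]
  · simp
  · exact (hi _).const_mul _
  · exact (hi _).const_mul _
  · exact ((hi _).const_mul _).add ((hi _).const_mul _)
  · exact (hi _).const_mul _

/-- Approximation, at the unit scale, of a function by one that is harmonic on a set `U` with holes
of radius `3` near every point. -/
theorem exists_harmonic_approximation_unit_scale {β : ℝ} (hβ : 0 < β)
    (hdim : (Module.finrank ℝ E : ℝ) = 2 * β + 2) {R : ℝ} (hR : 0 ≤ R) :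
    ∃ C, 0 < C ∧ ∀ (f : E → ℝ) (A : ℝ) (U : Set E), Continuous f → HasCompactSupport f →
      (∀ x y, dist x y ≤ 1 → |f x - f y| ≤ A) →
      (∀ x, ∃ p, dist x p ≤ R ∧ ∀ u ∈ U, 3 < dist u p) →
      ∃ G : E → ℝ, ContDiff ℝ ∞ G ∧ (∀ x ∈ U, Δ G x = 0) ∧ (∀ x, |f x - G x| ≤ C * A) ∧
        ∀ x, ‖fderiv ℝ G x‖ ≤ C * A := by
  obtain ⟨Φ, hΦ, hΦN, ⟨B, hB⟩, hΦ0, hκ⟩ := exists_regularized_fundamental_solution (E := E) hβ hdim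
  set η : E → ℝ := Δ Φ with hη_def
  set κ := ∫ x, η x with hκ_def
  have hη : ContDiff ℝ ∞ η := contDiff_laplacian hΦ
  have hηc : HasCompactSupport η := HasCompactSupport.intro (isCompact_closedBall (0 : E) 1)
    fun y hy => hΦ0 y (by simpa using hy)
  have hηi : Integrable η := hη.continuous.integrable_of_hasCompactSupport hηc
  have hLη := contDiff_laplacian hη
  have hLηc := hasCompactSupport_laplacian hηc
  have hLη0 : ∀ x, 1 < ‖x‖ → Δ η x = 0 := by
    intro x hx
    have : η =ᶠ[𝓝 x] fun _ => 0 := by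
      filter_upwards [(continuous_norm.isOpen_preimage _ isOpen_Ioi).mem_nhds hx] with y hy
      exact hΦ0 y hy
    rw [(InnerProductSpace.laplacian_congr_nhds this).eq_of_nhds]
    simp
  have hDη0 : ∀ v x, 1 < ‖x‖ → fderiv ℝ η x v = 0 := by
    intro v x hx
    have : η =ᶠ[𝓝 x] fun _ => 0 := by
      filter_upwards [(continuous_norm.isOpen_preimage _ isOpen_Ioi).mem_nhds hx] with y hy
      exact hΦ0 y hy
    rw [this.fderiv_eq]
    simp
  have hη' : Continuous (fderiv ℝ η) := (contDiff_infty.1 hη 1).continuous_fderiv one_ne_zero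
  -- All poles then lie within 2τ(R + 1) = 1 of p(y), so a hole of radius 3 leaves distance more
  -- than 2 from U.
  set τ : ℝ := 1 / (2 * (R + 1)) with hτ_def
  have hτ : 0 < τ := by positivity
  have hτR : 2 * τ * (R + 1) = 1 := by rw [hτ_def]; field_simp
  have hτ1 : 2 * τ ≤ 1 := by nlinarith
  obtain ⟨C₀, hC₀, hker⟩ := exists_abs_sub_extrapolate_kernel_le hβ hΦN hB hτ hτ1
    (by linarith : 0 ≤ R + 1)
  set J := ∫ y : E, (1 + ‖y‖) ^ (-(2 * β + 3)) with hJ_def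
  -- Integrability needs decay faster than the dimension 2β + 2; extrapolation of lower degree would
  -- not provide it.
  have hJi : Integrable fun y : E => (1 + ‖y‖) ^ (-(2 * β + 3)) :=
    integrable_one_add_norm (by rw [hdim]; linarith)
  have hJ : 0 ≤ J := integral_nonneg fun y => by positivity
  set I₁ := ∫ t, |Δ η t| with hI₁
  set I₂ := ∫ t, |smear η η t| with hI₂
  set I₃ := ∫ t, |η t| with hI₃
  set I₄ := ∫ t, ‖fderiv ℝ η t‖ with hI₄
  have n1 : 0 ≤ I₁ := integral_nonneg fun _ => abs_nonneg _
  have n2 : 0 ≤ I₂ := integral_nonneg fun _ => abs_nonneg _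
  have n3 : 0 ≤ I₃ := integral_nonneg fun _ => abs_nonneg _
  have n4 : 0 ≤ I₄ := integral_nonneg fun _ => norm_nonneg _
  -- The summands come from moving the poles, from replacing f * η * η by κ²f, and from the
  -- oscillation of f over a unit ball.
  set D := C₀ * J * I₁ + 2 * I₂ + κ ^ 2 with hD
  have hD0 : 0 ≤ D := by positivity
  set C := (|κ ^ 3|)⁻¹ * (D * (I₃ + I₄)) + 1 with hC
  refine ⟨C, by positivity, fun f A U hf hfc hA hU => ?_⟩
  have hA0 : 0 ≤ A := (abs_nonneg _).trans (hA 0 0 (by simp))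
  have hfi : Integrable f := hf.integrable_of_hasCompactSupport hfc
  obtain ⟨p, hp, hpR⟩ := exists_measurable_selection hU
  set φ := smear f (Δ η) with hφ_def
  have hφC : Continuous φ := (contDiff_smear hfi.locallyIntegrable hLη hLηc).continuous
  have hφc : HasCompactSupport φ := by
    rw [hφ_def, smear_eq_convolution]
    exact hfc.convolution _ hLηc
  have hφi : Integrable φ := hφC.integrable_of_hasCompactSupport hφc
  have hφA : ∀ x, |φ x| ≤ A * I₁ := by
    intro x
    have := abs_smear_sub_le hf hLη.continuous hLη0 (x := x) (c := f x) (D := A)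
      fun t ht => hA t x ht
    rwa [integral_laplacian_eq_zero hη hηc, mul_zero, sub_zero] at this
  -- The potential of φ is f * (Δη * Φ) = f * η * η. The kernel η * η has integral κ² and support of
  -- radius 2; the midpoint gives oscillation at most 2A there.
  have hF : ∀ x, |(∫ y, φ y * Φ (x - y)) - f x * κ ^ 2| ≤ 2 * A * I₂ := by
    intro x
    have hH : ContDiff ℝ ∞ (smear η η) := contDiff_smear hηi.locallyIntegrable hη hηc
    have := abs_smear_sub_le (u := f) hf hH.continuous (r := 2)
      (fun x hx => smear_self_eq_zero hΦ0 hx) (x := x) (c := f x) (D := 2 * A) fun t ht => ?_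
    · rw [integral_smear_self hηi] at this
      rw [integral_smear_mul_sub hf hfc hLη.continuous hLηc hΦ.continuous]
      simp_rw [integral_sub_mul_laplacian hΦ hη hηc]
      convert this using 4
      rw [smear]
      congr 1
      funext t
      congr 1
      rw [smear]
      exact integral_congr_ae (Filter.Eventually.of_forall fun s => mul_comm _ _)
    · have h1 := hA t (midpoint ℝ t x) (by
        rw [dist_left_midpoint]; norm_num; linarith)
      have h2 := hA (midpoint ℝ t x) x (by
        rw [dist_midpoint_right]; norm_num; linarith)
      have := abs_sub_le (f t) (f (midpoint ℝ t x)) (f x)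
      linarith
  set T := extrapolatedKernel Φ τ p with hT_def
  have hTm := measurable_extrapolatedKernel hΦ.continuous τ hp
  have hTB := abs_extrapolatedKernel_le hB τ p
  set G₀ : E → ℝ := fun x => ∫ y, φ y * T x y with hG₀_def
  have hG₀c : Continuous G₀ := continuous_integral_mul hφi (fun x => hTm.of_uncurry_left)
    (continuous_extrapolatedKernel hΦ.continuous τ p) hTB
  have hFG : ∀ x, |(∫ y, φ y * Φ (x - y)) - G₀ x| ≤ C₀ * J * I₁ * A := by
    intro x
    have i1 : Integrable fun y => φ y * Φ (x - y) :=
      (hφC.mul (hΦ.continuous.comp (continuous_const.sub continuous_id))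
        ).integrable_of_hasCompactSupport hφc.mul_right
    have i2 : Integrable fun y => φ y * T x y :=
      hφi.mul_bdd (hTm.of_uncurry_left (x := x)).aestronglyMeasurable
        (Filter.Eventually.of_forall (hTB x))
    rw [hG₀_def, ← integral_sub i1 i2]
    have e : C₀ * J * I₁ * A = ∫ y, A * I₁ * C₀ * (1 + ‖x - y‖) ^ (-(2 * β + 3)) := by
      rw [integral_const_mul,
        integral_sub_left_eq_self (fun y : E => (1 + ‖y‖) ^ (-(2 * β + 3))) volume x]
      ring
    rw [e]
    refine norm_integral_le_of_norm_le (f := fun y => φ y * Φ (x - y) - φ y * T x y)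
      ((hJi.comp_sub_left x).const_mul _) (Filter.Eventually.of_forall fun y => ?_)
    rw [← mul_sub, norm_mul, mul_assoc (A * I₁)]
    refine mul_le_mul (hφA y) ?_ (norm_nonneg _) (by positivity)
    have hyp : ‖y - p y‖ ≤ R + 1 := by rw [← dist_eq_norm]; exact (hpR y).1
    have := hker (x - p y) (y - p y) hyp
    simp only [sub_sub_sub_cancel_right] at this
    rw [Real.norm_eq_abs, hT_def, extrapolatedKernel]
    simpa only [towards, sub_sub] using this
  have hosc : ∀ x t, dist t x ≤ 1 → |G₀ t - κ ^ 2 * f x| ≤ D * A := by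
    intro x t ht
    have h1 := abs_sub_le (G₀ t) (∫ y, φ y * Φ (t - y)) (κ ^ 2 * f x)
    have h2 := hFG t
    rw [abs_sub_comm] at h2
    have h3 := abs_sub_le (∫ y, φ y * Φ (t - y)) (f t * κ ^ 2) (κ ^ 2 * f x)
    have h4 := hF t
    have h5 : |f t * κ ^ 2 - κ ^ 2 * f x| ≤ κ ^ 2 * A := by
      rw [mul_comm, ← mul_sub, abs_mul, abs_of_nonneg (sq_nonneg κ)]
      exact mul_le_mul_of_nonneg_left (hA t x ht) (sq_nonneg κ)
    rw [hD]
    linarith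
  have hG₀l : LocallyIntegrable G₀ := hG₀c.locallyIntegrable
  -- A last smoothing by η makes the potential harmonic on U and controls its gradient; it
  -- multiplies the main term by one more κ.
  set G₁ := smear G₀ η with hG₁_def
  have hG₁ : ContDiff ℝ ∞ G₁ := contDiff_smear hG₀l hη hηc
  have hG₁f : ∀ x, |G₁ x - κ ^ 2 * f x * κ| ≤ D * A * I₃ := fun x =>
    abs_smear_sub_le hG₀c hη.continuous hΦ0 (hosc x)
  have hG₁d : ∀ x, ‖fderiv ℝ G₁ x‖ ≤ D * A * I₄ := by
    intro x
    refine ContinuousLinearMap.opNorm_le_bound _ (by positivity) fun v => ?_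
    have := abs_smear_sub_le hG₀c (contDiff_fderiv_apply_const hη v).continuous (hDη0 v) (hosc x)
    rw [integral_fderiv_apply_eq_zero hη hηc, mul_zero, sub_zero] at this
    rw [hG₁_def, fderiv_smear hG₀l hη hηc, mul_assoc, Real.norm_eq_abs]
    refine this.trans (mul_le_mul_of_nonneg_left ?_ (by positivity))
    rw [hI₄, ← integral_mul_const]
    refine integral_mono_of_nonneg (Filter.Eventually.of_forall fun _ => abs_nonneg _) ?_
      (Filter.Eventually.of_forall fun t => (fderiv ℝ η t).le_opNorm v)
    exact (hη'.norm.integrable_of_hasCompactSupport (hηc.fderiv ℝ).norm).mul_const _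
  have hG₁h : ∀ x ∈ U, Δ G₁ x = 0 := by
    intro x hx
    rw [hG₁_def, laplacian_smear hG₀l hη hηc, hG₀_def, smear_integral_swap hφi
      (hLη.continuous.integrable_of_hasCompactSupport hLηc) hTm hTB]
    refine integral_eq_zero_of_ae (Filter.Eventually.of_forall fun y => ?_)
    simp only [Pi.zero_apply]
    rw [integral_extrapolatedKernel_mul_laplacian_eq_zero hΦ hΦ0 hη hΦ0, mul_zero]
    have hpole : ∀ s, 0 ≤ s → s ≤ 2 * τ → 2 < dist x (towards p s y) := by
      intro s hs hs'
      have h1 := (hpR y).2 x hx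
      have h2 : dist (towards p s y) (p y) ≤ 1 := by
        rw [towards, dist_eq_norm, add_sub_cancel_left, norm_smul, Real.norm_of_nonneg hs,
          ← dist_eq_norm, ← hτR]
        exact mul_le_mul hs' (hpR y).1 dist_nonneg (by positivity)
      linarith [dist_triangle x (towards p s y) (p y)]
    rintro s (rfl | rfl | rfl)
    · exact hpole 0 le_rfl (by positivity)
    · exact hpole τ hτ.le (by linarith)
    · exact hpole (2 * τ) (by positivity) le_rfl
  have hκ3 : κ ^ 3 ≠ 0 := pow_ne_zero _ hκ
  have hCA : ∀ I, 0 ≤ I → I ≤ I₃ + I₄ → (|κ ^ 3|)⁻¹ * (D * A * I) ≤ C * A := by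
    intro I hI hI'
    have : (|κ ^ 3|)⁻¹ * (D * A * I) ≤ (|κ ^ 3|)⁻¹ * (D * A * (I₃ + I₄)) := by gcongr
    rw [hC]
    linarith
  refine ⟨(κ ^ 3)⁻¹ • G₁, contDiff_const.smul hG₁, fun x hx => ?_, fun x => ?_, fun x => ?_⟩
  · rw [InnerProductSpace.laplacian_smul _ (contDiff_infty.1 hG₁ 2).contDiffAt, hG₁h x hx, smul_zero]
  · have e : f x - ((κ ^ 3)⁻¹ • G₁) x = -((κ ^ 3)⁻¹ * (G₁ x - κ ^ 2 * f x * κ)) := by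
      simp only [Pi.smul_apply, smul_eq_mul]
      field_simp
      ring
    rw [e, abs_neg, abs_mul, abs_inv]
    exact (mul_le_mul_of_nonneg_left (hG₁f x) (by positivity)).trans (hCA _ n3 (by linarith))
  · rw [fderiv_const_smul (hG₁.differentiable (by simp) x), norm_smul, norm_inv, Real.norm_eq_abs]
    exact (mul_le_mul_of_nonneg_left (hG₁d x) (by positivity)).trans (hCA _ n4 (by linarith))

end

end HarmonicApproximation

/-! ### Moduli of continuity, extension, porosity and rescaling -/

section Assembly

open MeasureTheory Laplacian Topology

theorem IsModulusOfContinuity.add_le {ω : ℝ → ℝ} (hω : IsModulusOfContinuity ω) {a b : ℝ}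
    (ha : 0 ≤ a) (hb : 0 ≤ b) : ω (a + b) ≤ ω a + ω b := by
  rcases (add_nonneg ha hb).eq_or_lt with h | h
  · have ha0 : a = 0 := by linarith
    have hb0 : b = 0 := by linarith
    simp [ha0, hb0, hω.map_zero]
  -- By concavity ω lies above its chord from 0 to a + b, and the chord starts at ω(0) = 0.
  · have key : ∀ t, 0 ≤ t → t ≤ a + b → t / (a + b) * ω (a + b) ≤ ω t := by
      intro t ht ht'
      have := hω.concaveOn.2 (Set.mem_Ici.2 h.le) (Set.self_mem_Ici (a := (0 : ℝ)))
        (show 0 ≤ t / (a + b) by positivity)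
        (show 0 ≤ 1 - t / (a + b) from sub_nonneg.2 ((div_le_one h).2 ht')) (by ring)
      simpa [hω.map_zero, div_mul_cancel₀ t h.ne'] using this
    have h1 := key a ha (by linarith)
    have h2 := key b hb (by linarith)
    have h3 : a / (a + b) * ω (a + b) + b / (a + b) * ω (a + b) = ω (a + b) := by
      field_simp
    linarith

/-- McShane's infimum formula: subadditivity and monotonicity make Ω(dist x y) satisfy the triangle
inequality. -/
theorem exists_extension_of_modulus {X : Type*} [PseudoMetricSpace X] {Ω : ℝ → ℝ}
    (hadd : ∀ a b, 0 ≤ a → 0 ≤ b → Ω (a + b) ≤ Ω a + Ω b) (hmono : MonotoneOn Ω (Set.Ici 0))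
    (h0 : Ω 0 = 0) {S : Set X} (hS : S.Nonempty) {f : X → ℝ}
    (hf : ∀ x ∈ S, ∀ y ∈ S, |f x - f y| ≤ Ω (dist x y)) :
    ∃ F : X → ℝ, (∀ x ∈ S, F x = f x) ∧ ∀ x y, |F x - F y| ≤ Ω (dist x y) := by
  have tri : ∀ x y z : X, Ω (dist x z) ≤ Ω (dist x y) + Ω (dist y z) := fun x y z =>
    (hmono dist_nonneg (add_nonneg dist_nonneg dist_nonneg) (dist_triangle x y z)).trans
      (hadd _ _ dist_nonneg dist_nonneg)
  obtain ⟨s, hs⟩ := hS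
  have : Nonempty S := ⟨⟨s, hs⟩⟩
  have hbdd : ∀ x : X, BddBelow (Set.range fun y : S => f y + Ω (dist x y)) := by
    intro x
    refine ⟨f s - Ω (dist s x), ?_⟩
    rintro _ ⟨y, rfl⟩
    have h1 := (abs_le.1 (hf s hs y y.2)).2
    have h2 := tri s x y
    simp only
    linarith
  set F : X → ℝ := fun x => ⨅ y : S, (f y + Ω (dist x y)) with hF
  have hle : ∀ x x', F x ≤ F x' + Ω (dist x x') := by
    intro x x'
    rw [← sub_le_iff_le_add]
    refine le_ciInf fun y => ?_
    have h1 := ciInf_le (hbdd x) y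
    have h2 := tri x x' y
    simp only [hF]
    linarith
  refine ⟨F, fun x hx => le_antisymm ?_ ?_, fun x y => abs_le.2 ⟨?_, ?_⟩⟩
  · have := ciInf_le (hbdd x) ⟨x, hx⟩
    simpa [h0] using this
  · refine le_ciInf fun y => ?_
    have := (abs_le.1 (hf x hx y y.2)).2
    linarith
  · have := hle y x
    rw [dist_comm] at this
    linarith
  · linarith [hle x y]

section

variable {d : ℕ}

local notation "𝔼" => EuclideanSpace ℝ (Fin d)

theorem abs_sub_le_of_memLip {ω : ℝ → ℝ} (hω : IsModulusOfContinuity ω) {K : Set 𝔼} {f : 𝔼 → ℝ}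
    (hf : MemLip ω K f) {x y : 𝔼} (hx : x ∈ K) (hy : y ∈ K) :
    |f x - f y| ≤ (lipSeminorm ω K f).toReal * ω (dist x y) := by
  rcases eq_or_ne x y with rfl | hxy
  · simp [hω.map_zero]
  have hle : ENNReal.ofReal |f x - f y| / ENNReal.ofReal (ω (dist x y)) ≤ lipSeminorm ω K f :=
    le_iSup₂_of_le x hx (le_iSup₂_of_le y hy (le_iSup_of_le hxy le_rfl))
  have hω0 := hω.nonneg _ (dist_nonneg (x := x) (y := y))
  rcases hω0.eq_or_lt with h0 | h0
  · rcases (abs_nonneg (f x - f y)).eq_or_lt with h1 | h1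
    · rw [← h0, ← h1, mul_zero]
    · rw [← h0, ENNReal.ofReal_zero, ENNReal.div_zero (by simpa using h1)] at hle
      exact absurd hf.2 (not_lt.2 hle)
  · rw [← ENNReal.ofReal_div_of_pos h0] at hle
    have := ENNReal.toReal_mono hf.2.ne hle
    rw [ENNReal.toReal_ofReal (by positivity)] at this
    exact (div_le_iff₀ h0).1 this

theorem memLip_of_abs_sub_le {ω : ℝ → ℝ} {K : Set 𝔼} {f : 𝔼 → ℝ} (hf : ContinuousOn f K) {C : ℝ}
    (hC : 0 ≤ C) (h : ∀ x ∈ K, ∀ y ∈ K, |f x - f y| ≤ C * ω (dist x y)) : MemLip ω K f := by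
  refine ⟨hf, lt_of_le_of_lt ?_ (ENNReal.ofReal_lt_top (r := C))⟩
  refine iSup₂_le fun x hx => iSup₂_le fun y hy => iSup_le fun _ => ?_
  refine ENNReal.div_le_of_le_mul ?_
  rw [← ENNReal.ofReal_mul hC]
  exact ENNReal.ofReal_le_ofReal (h x hx y hy)

theorem exists_compactlySupported_extension {ω : ℝ → ℝ} (hω : IsModulusOfContinuity ω)
    {K : Set 𝔼} (hK : Bornology.IsBounded K) (hne : K.Nonempty) {f : 𝔼 → ℝ} {M : ℝ} (hM : 0 ≤ M)
    (hf : ∀ x ∈ K, ∀ y ∈ K, |f x - f y| ≤ M * ω (dist x y)) :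
    ∃ (F : 𝔼 → ℝ) (c : ℝ), Continuous F ∧ HasCompactSupport F ∧ (∀ x ∈ K, f x = F x + c) ∧
      ∀ x y, |F x - F y| ≤ M * ω (dist x y) := by
  classical
  obtain ⟨x₀, hx₀⟩ := hne
  obtain ⟨L, hL⟩ := hK.subset_closedBall x₀
  set S := K ∪ {x | 2 * L ≤ dist x x₀} with hS
  set f₀ : 𝔼 → ℝ := fun x => if x ∈ K then f x - f x₀ else 0 with hf₀
  have hout : ∀ x ∈ K, ∀ y ∈ S, y ∉ K → |f x - f x₀| ≤ M * ω (dist x y) := by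
    intro x hx y hy hyK
    have hy' : 2 * L ≤ dist y x₀ := hy.resolve_left hyK
    have hxL : dist x x₀ ≤ L := hL hx
    have : dist x x₀ ≤ dist x y := by
      have := dist_triangle y x x₀
      rw [dist_comm y x] at this
      linarith
    exact (hf x hx x₀ hx₀).trans
      (mul_le_mul_of_nonneg_left (hω.monotoneOn dist_nonneg dist_nonneg this) hM)
  obtain ⟨F, hFS, hF⟩ := exists_extension_of_modulus (Ω := fun t => M * ω t) (S := S) (f := f₀)
    (fun a b ha hb => by
      rw [← mul_add]; exact mul_le_mul_of_nonneg_left (hω.add_le ha hb) hM)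
    (fun a ha b hb hab => mul_le_mul_of_nonneg_left (hω.monotoneOn ha hb hab) hM)
    (by simp [hω.map_zero]) ⟨x₀, Or.inl hx₀⟩ (by
      intro x hx y hy
      by_cases hxK : x ∈ K <;> by_cases hyK : y ∈ K
      · simpa [hf₀, hxK, hyK] using hf x hxK y hyK
      · simpa [hf₀, hxK, hyK] using hout x hxK y hy hyK
      · have := hout y hyK x hx hxK
        rw [dist_comm] at this
        simp only [hf₀, hxK, hyK, if_true, if_false, zero_sub, abs_neg]
        exact this
      · simp only [hf₀, hxK, hyK, if_false, sub_zero, abs_zero]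
        exact mul_nonneg hM (hω.nonneg _ dist_nonneg))
  refine ⟨F, f x₀, ?_, ?_, fun x hx => ?_, hF⟩
  · rw [continuous_iff_continuousAt]
    intro x
    rw [ContinuousAt, tendsto_iff_dist_tendsto_zero]
    have hd : Filter.Tendsto (fun y => dist y x) (𝓝 x) (𝓝[Set.Ici 0] 0) :=
      tendsto_nhdsWithin_iff.2 ⟨tendsto_iff_dist_tendsto_zero.1 Filter.tendsto_id,
        Filter.Eventually.of_forall fun _ => dist_nonneg⟩
    have h1 := ((hω.continuousOn 0 Set.self_mem_Ici).tendsto.comp hd).const_mul M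
    rw [hω.map_zero, mul_zero] at h1
    exact squeeze_zero (fun _ => dist_nonneg) (fun y => hF y x) h1
  · refine HasCompactSupport.intro (isCompact_closedBall x₀ (2 * L)) fun x hx => ?_
    have hx' : 2 * L < dist x x₀ := by simpa using hx
    rw [hFS x (Or.inr hx'.le)]
    have : x ∉ K := fun h => by
      have h1 : dist x x₀ ≤ L := hL h
      have h2 : dist x₀ x₀ ≤ L := hL hx₀
      rw [dist_self] at h2
      linarith
    simp [hf₀, this]
  · rw [hFS x (Or.inl hx)]
    simp [hf₀, hx]

theorem IsPorousCompact.exists_holes {K : Set 𝔼} (hd : 0 < d) (hK : IsPorousCompact K) :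
    ∃ R, 0 ≤ R ∧ ∀ (δ : ℝ), 0 < δ → ∀ x : 𝔼, ∃ p, dist x p ≤ R * δ ∧
      ∀ k ∈ K, 5 * δ ≤ dist k p := by
  obtain ⟨c, hc0, hc1, h⟩ := hK.exists_hole
  refine ⟨5 / c, by positivity, fun δ hδ x => ?_⟩
  have hr : 0 < 5 / c * δ := by positivity
  obtain ⟨y, s, hs, hsub, hdisj, hvol⟩ := h x (5 / c * δ) hr
  have : Nonempty (Fin d) := ⟨⟨0, hd⟩⟩
  have hpow : (5 * δ) ^ d ≤ s ^ d := by
    rw [Measure.addHaar_ball _ _ hr.le, Measure.addHaar_ball _ _ hs.le, ← mul_assoc,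
      ENNReal.mul_le_mul_iff_left (Metric.measure_ball_pos _ _ one_pos).ne'
        measure_ball_lt_top.ne, ← ENNReal.ofReal_mul hc0.le,
      ENNReal.ofReal_le_ofReal_iff (by positivity), finrank_euclideanSpace_fin] at hvol
    refine le_trans ?_ hvol
    have h1 : 5 / c * δ = (5 * δ) * c⁻¹ := by ring
    have h2 : 1 ≤ c * c⁻¹ ^ d := by
      calc (1 : ℝ) = c * c⁻¹ := (mul_inv_cancel₀ hc0.ne').symm
        _ ≤ c * c⁻¹ ^ d := by
          gcongr
          exact le_self_pow₀ ((one_le_inv₀ hc0).2 hc1.le) hd.ne'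
    rw [h1, mul_pow (5 * δ)]
    calc (5 * δ) ^ d = (5 * δ) ^ d * 1 := (mul_one _).symm
      _ ≤ (5 * δ) ^ d * (c * c⁻¹ ^ d) := by gcongr
      _ = _ := by ring
  have hs5 : 5 * δ ≤ s := le_of_pow_le_pow_left₀ hd.ne' hs.le hpow
  refine ⟨y, ?_, fun k hk => ?_⟩
  · have := hsub (Metric.mem_ball_self hs)
    rw [dist_comm]
    exact (Metric.mem_ball.1 this).le
  · by_contra! hlt
    have : k ∈ Metric.ball y s ∩ K := ⟨Metric.mem_ball.2 (hlt.trans_le hs5), hk⟩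
    rw [hdisj] at this
    exact this

theorem norm_gradient_eq (G : 𝔼 → ℝ) (x : 𝔼) : ‖gradient G x‖ = ‖fderiv ℝ G x‖ := by
  simp [gradient]

theorem abs_sub_le_of_harmonicallyApproximable {ω : ℝ → ℝ} (hω : IsModulusOfContinuity ω)
    {K : Set 𝔼} {f : 𝔼 → ℝ} {A₁ A₂ : ℝ} (h : HarmonicallyApproximable ω K f A₁ A₂) {x y : 𝔼}
    (hx : x ∈ K) (hy : y ∈ K) : |f x - f y| ≤ (4 * |A₁| + |A₂|) * ω (dist x y) := by
  rcases eq_or_ne x y with rfl | hxy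
  · simp [hω.map_zero]
  set t := dist x y with ht
  have ht0 : 0 < t := dist_pos.2 hxy
  obtain ⟨G, hG, hfG, hgrad⟩ := h (2 * t) (by positivity)
  have hsub : Metric.ball x (2 * t) ⊆ Metric.thickening (2 * t) K := fun z hz =>
    Metric.mem_thickening_iff.2 ⟨x, hx, hz⟩
  have hω0 : 0 ≤ ω (2 * t) := hω.nonneg _ (by positivity)
  have hω2 : ω (2 * t) ≤ 2 * ω t := by
    have := hω.add_le ht0.le ht0.le
    rwa [← two_mul, ← two_mul] at this
  have hmv := (convex_ball x (2 * t)).norm_image_sub_le_of_norm_fderiv_le (𝕜 := ℝ) (f := G)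
    (fun z hz => (hG z (hsub hz)).1.differentiableAt two_ne_zero)
    (fun z hz => (norm_gradient_eq G z).symm.le.trans (hgrad z (hsub hz)))
    (x := y) (y := x) (Metric.mem_ball.2 (by rw [dist_comm]; linarith))
    (Metric.mem_ball_self (by positivity))
  rw [← dist_eq_norm x y, ← ht, Real.norm_eq_abs] at hmv
  have e : A₂ * (ω (2 * t) / (2 * t)) * t = A₂ * (ω (2 * t) / 2) := by field_simp
  have b2 : A₂ * (ω (2 * t) / 2) ≤ |A₂| * ω t :=
    mul_le_mul (le_abs_self _) (by linarith) (by positivity) (abs_nonneg _)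
  have b1 : A₁ * ω (2 * t) ≤ |A₁| * (2 * ω t) :=
    mul_le_mul (le_abs_self _) hω2 hω0 (abs_nonneg _)
  have h1 := abs_sub_le (f x) (G x) (f y)
  have h2 := abs_sub_le (G x) (G y) (f y)
  have h3 := hfG x hx
  have h4 := hfG y hy
  rw [abs_sub_comm] at h4
  linarith

theorem exists_const_harmonicallyApproximable (hd : 2 < d) {K : Set 𝔼} (hK : IsPorousCompact K)
    {ω : ℝ → ℝ} (hω : IsModulusOfContinuity ω) :
    ∃ C, 0 < C ∧ ∀ (f : 𝔼 → ℝ) (M : ℝ), 0 ≤ M →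
      (∀ x ∈ K, ∀ y ∈ K, |f x - f y| ≤ M * ω (dist x y)) →
      HarmonicallyApproximable ω K f (C * M) (C * M) := by
  obtain ⟨R, hR, hholes⟩ := hK.exists_holes (by omega)
  have hd' : (2 : ℝ) < d := by exact_mod_cast hd
  obtain ⟨C, hC, hunit⟩ := exists_harmonic_approximation_unit_scale (E := 𝔼)
    (β := (d : ℝ) / 2 - 1) (by linarith) (by rw [finrank_euclideanSpace_fin]; ring) hR
  refine ⟨C, hC, fun f M hM hf δ hδ => ?_⟩
  rcases K.eq_empty_or_nonempty with rfl | hne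
  · exact ⟨0, by simp [InnerProductSpace.HarmonicOnNhd]⟩
  obtain ⟨F, c, hF, hFc, hfF, hFω⟩ := exists_compactlySupported_extension hω hK.isBounded hne hM hf
  have hdist : ∀ u v : 𝔼, dist (δ • u) (δ • v) = δ * dist u v := fun u v => by
    rw [dist_smul₀, Real.norm_of_nonneg hδ.le]
  obtain ⟨G, hG, hΔ, hGF, hGd⟩ := hunit (fun u => F (δ • u)) (M * ω δ)
    {u | δ • u ∈ Metric.thickening δ K} (hF.comp (continuous_const_smul δ))
    (hFc.comp_homeomorph (Homeomorph.smulOfNeZero δ hδ.ne')) (by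
      intro u v huv
      refine (hFω _ _).trans (mul_le_mul_of_nonneg_left ?_ hM)
      refine hω.monotoneOn dist_nonneg hδ.le ?_
      rw [hdist]
      exact mul_le_of_le_one_right hδ.le huv) (by
      intro u
      obtain ⟨p, hp, hpK⟩ := hholes δ hδ (δ • u)
      have ep : p = δ • (δ⁻¹ • p) := (smul_inv_smul₀ hδ.ne' p).symm
      refine ⟨δ⁻¹ • p, ?_, fun v hv => ?_⟩
      · rw [ep, hdist, mul_comm] at hp
        exact le_of_mul_le_mul_right hp hδ
      · have hv' : δ • v ∈ Metric.thickening δ K := hv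
        obtain ⟨k, hk, hkv⟩ := Metric.mem_thickening_iff.1 hv'
        rw [dist_comm] at hkv
        have h1 := hpK k hk
        have h2 := dist_triangle k (δ • v) p
        have h3 : 3 * δ < dist (δ • v) p := by linarith
        rw [ep, hdist, mul_comm] at h3
        exact lt_of_mul_lt_mul_left h3 hδ.le)
  have hG' : ContDiff ℝ (⊤ : ℕ∞) fun x => G x + c := hG.add contDiff_const
  have hGs : ContDiff ℝ (⊤ : ℕ∞) fun x => G (δ⁻¹ • x) + c := hG'.comp (contDiff_const_smul δ⁻¹)
  refine ⟨fun x => G (δ⁻¹ • x) + c, fun x hx => ⟨(contDiff_infty.1 hGs 2).contDiffAt, ?_⟩,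
    fun x hx => ?_, fun x hx => ?_⟩
  · filter_upwards [Metric.isOpen_thickening.mem_nhds hx] with z hz
    have hz' : δ • (δ⁻¹ • z) ∈ Metric.thickening δ K := by
      rw [smul_inv_smul₀ hδ.ne']
      exact hz
    have h2 : Δ G (δ⁻¹ • z) = 0 := hΔ _ hz'
    rw [laplacian_comp_smul hG', laplacian_fun_add_const hG, h2, mul_zero, Pi.zero_apply]
  · have := hGF (δ⁻¹ • x)
    rw [smul_inv_smul₀ hδ.ne'] at this
    rw [hfF x hx, add_sub_add_right_eq_sub, mul_assoc]
    exact this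
  · rw [norm_gradient_eq, fderiv_add_const, fderiv_comp_smul, norm_smul, norm_inv,
      Real.norm_of_nonneg hδ.le]
    calc δ⁻¹ * ‖fderiv ℝ G (δ⁻¹ • x)‖ ≤ δ⁻¹ * (C * (M * ω δ)) := by gcongr; exact hGd _
      _ = _ := by ring

end

end Assembly

theorem theorem1 (d : ℕ) (hd : 2 < d) (K : Set (EuclideanSpace ℝ (Fin d)))
    (hK : IsPorousCompact K) (ω : ℝ → ℝ) (hω : IsModulusOfContinuity ω) :
    ∃ C₁ C₂ : ℝ, 0 < C₁ ∧ 0 < C₂ ∧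
      ∀ f : EuclideanSpace ℝ (Fin d) → ℝ, ContinuousOn f K →
        (MemLip ω K f ↔ ∃ A₁ A₂ : ℝ, HarmonicallyApproximable ω K f A₁ A₂) ∧
        (MemLip ω K f →
          HarmonicallyApproximable ω K f
            (C₁ * (lipSeminorm ω K f).toReal) (C₂ * (lipSeminorm ω K f).toReal)) := by
  obtain ⟨C, hC, hmain⟩ := exists_const_harmonicallyApproximable hd hK hω
  refine ⟨C, C, hC, hC, fun f hf => ?_⟩
  have hforward : MemLip ω K f → HarmonicallyApproximable ω K f
      (C * (lipSeminorm ω K f).toReal) (C * (lipSeminorm ω K f).toReal) := fun h =>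
    hmain f _ ENNReal.toReal_nonneg fun x hx y hy => abs_sub_le_of_memLip hω h hx hy
  refine ⟨⟨fun h => ⟨_, _, hforward h⟩, ?_⟩, hforward⟩
  rintro ⟨A₁, A₂, h⟩
  exact memLip_of_abs_sub_le hf (by positivity) fun x hx y hy =>
    abs_sub_le_of_harmonicallyApproximable hω h hx hy
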